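/- **Setting.** Let $\mathcal X,\mathcal Y,\mathcal A,\hat{\mathcal X}$ be finite alphabets, $P_X$ a pmf on $\mathcal X$ with $P_X(x)>0$ for all $x$, $P_{Y|X,A}(y|x,a)$ a conditional pmf, $d:\mathcal X\times\hat{\mathcal X}\to[0,\infty)$ a distortion such that every $x$ has some $\hat x$ with $d(x,\hat x)=0$, and $\Delta:\mathcal A\to[0,\infty)$ a cost with $\Delta(a)=0$ for some $a$. Logarithms are to base 2, and $0\log 0=0$. The rate-distortion-cost function is $$R(D,C)=\min\; I(X;A)+I(X;U|Y,A),$$ over all finite alphabets $\mathcal U$, conditional pmfs $P_{U|X}$ and maps $\eta:\mathcal U\to\mathcal A$, where $P_{X,Y,A,U}(x,y,a,u)=P_X(x)P_{U|X}(u|x)\mathbf 1_{\{\eta(u)=a\}}P_{Y|X,A}(y|x,a)$, subject to $\mathbb E[d(X,\hat X^{\rm opt}(U,Y))]\le D$ and $\mathbb E[\Delta(A)]\le C$, with $\hat X^{\rm opt}(u,y)\in\arg\min_{\hat x}\mathbb E[d(X,\hat x)|U=u,Y=y]$. Let $\mathcal T=\hat{\mathcal X}^{\mathcal Y}\times\mathcal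 A$ be the set of Shannon strategies $t=((t(y))_{y},\mathrm a(t))$, and $\mathcal T^a=\{t:\mathrm a(t)=a\}$. For a conditional pmf $P_{T|X}$ put $P_{X,Y,T}(x,y,t)=P_X(x)P_{T|X}(t|x)P_{Y|X,A}(y|x,\mathrm a(t))$, and let $D(P_{T|X})=\mathbb E[d(X,T(Y))]$, $C(P_{T|X})=\mathbb E[\Delta(\mathrm a(T))]$. Fix $s\le 0$, $m\le 0$, and define $$\begin{aligned}F(P_{T|X},Q_{T,Y},Q_A)={}&\sum_{y,a}P_{Y,A}(y,a)\log\frac{P_{Y,A}(y,a)}{Q_A(a)}-\sum_{x,y,t}P_{X,Y,T}(x,y,t)\log P_{Y|X,A}(y|x,\mathrm a(t))\\&+\sum_xP_X(x)D_{KL}\big(P_{Y,T|X}(\cdot,\cdot|x)\,\|\,Q_{T,Y}\big)-s\,D(P_{T|X})-m\,C(P_{T|X}).\end{aligned}$$ *Algorithm 2* (parameter $\beta\in(0,1)$, input $Q_{T,Y},Q_A$). Let $$\alpha_{t,x}=Q_A(\mathrm a(t))\,2^{m\Delta(\mathrm a(t))}\,2^{\sum_yP_{Y|X,A}(y|x,\mathrm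 a(t))[s\,d(x,t(y))+\log Q_{T,Y}(t,y)]},\qquad \alpha_{a,x}=\sum_{t\in\mathcal T^a}\alpha_{t,x},$$ $$h_{a|x}(P_{A|X},\mu_x)=\frac{2^{\mu_x}\alpha_{a,x}}{\prod_y\big[\sum_{\tilde x}P_X(\tilde x)P_{Y|X,A}(y|\tilde x,a)P_{A|X}(a|\tilde x)\big]^{P_{Y|X,A}(y|x,a)}},\qquad g_{a|x}=P_{A|X}(a|x)^{\beta}\,h_{a|x}^{1-\beta}.$$ Start from $\mu^{(0)}_x=1$ and $P^{(0)}_{A|X}(a|x)=1/|\mathcal T|$. For $i=0,1,2,\dots$ let $P^{(i+1)}_{A|X}$ be the limit of the iterates of $P_{A|X}\mapsto g(P_{A|X},\mu^{(i)})$ started at $P^{(i)}_{A|X}$, and put $$\mu_x^{(i+1)}=\mu_x^{(i)}+\frac{\theta_i}{P_X(x)}\Big(1-\sum_aP^{(i+1)}_{A|X}(a|x)\Big),\qquad \theta_i=\frac1{i+1}$$ (so the successive steps are $1,\frac12,\frac13,\dots$). The output is $P_{T|X}(t|x)=\frac{\alpha_{t,x}}{\alpha_{\mathrm a(t),x}}\lim_iP^{(i)}_{A|X}(\mathrm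 a(t)|x)$. *Algorithm 1.* Start from a conditional pmf $P^0_{T|X}$ with all entries positive. For $k=0,1,2,\dots$ let $Q_A^k=P_A$ and $Q_{T,Y}^k=P_{T,Y}$ be the marginals under $P^k_{T|X}$, and let $P^{k+1}_{T|X}$ be the output of Algorithm 2 on $(Q^k_{T,Y},Q^k_A)$. The computed rate is $R_k=sD(P^{k+1}_{T|X})+mC(P^{k+1}_{T|X})+F(P^{k+1}_{T|X},Q^k_{T,Y},Q^k_A)$. **Proposition.** For all $s\le0$, $m\le 0$, $\beta\in(0,1)$ and every conditional pmf $P^0_{T|X}$ with positive entries, all limits above exist and the algorithm converges to $R(D_{s,m},C_{s,m})$. Precisely: 1. In every round $k$, with $(Q_{T,Y},Q_A)=(Q^k_{T,Y},Q^k_A)$: - For every $\mu\in\mathbb R^{\mathcal X}$, put $q_{a|x}=\log P_{A|X}(a|x)$, $H(q)=\log h(2^q,\mu)$ and $G(q)=\log g(2^q,\mu)=\beta q+(1-\beta)H(q)$. Then $H$ and $G$ have one and the same unique fixed point $q^*$. For each $r>0$, $G$ maps the closed sup-norm ball of radius $r$ around $q^*$ into itself and is a sup-norm contraction on it, with some constant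 $L<1$ (which may depend on $r$). From every positive starting point the iterates of $g(\cdot,\mu)$ converge to $2^{q^*}$. - In Algorithm 2 every inner fixed-point iteration converges, and $\mu^{(i)}$ and $P^{(i)}_{A|X}$ converge as $i\to\infty$. The output $P^{k+1}_{T|X}$ is a conditional pmf that minimizes $F(\cdot,Q^k_{T,Y},Q^k_A)$ over all conditional pmfs $P_{T|X}$. 2. As $k\to\infty$, $P^k_{T|X}$ converges to a conditional pmf $P^*_{T|X}$ that minimizes $$I(X;\mathrm a(T))+I(X;T|Y,\mathrm a(T))-s\,\mathbb E[d(X,T(Y))]-m\,\mathbb E[\Delta(\mathrm a(T))]$$ over all conditional pmfs $P_{T|X}$. With $D_{s,m}=D(P^*_{T|X})$ and $C_{s,m}=C(P^*_{T|X})$ we have $D(P^k_{T|X})\to D_{s,m}$, $C(P^k_{T|X})\to C_{s,m}$ and $R_k\to R(D_{s,m},C_{s,m})$, and the minimum defining $R(D_{s,m},C_{s,m})$ is attained. -/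

import Mathlib

open Filter Topology

noncomputable section

/-- A kernel (conditional pmf) `K x u = P(u | x)` between finite alphabets. -/
def IsKernel {X U : Type*} [Fintype U] (K : X → U → ℝ) : Prop :=
  (∀ x u, 0 ≤ K x u) ∧ ∀ x, ∑ u, K x u = 1

/-- Mutual information (in bits) of a joint pmf on two finite alphabets. -/
def mutualInfo {α β : Type*} [Fintype α] [Fintype β] (p : α → β → ℝ) : ℝ :=
  ∑ a, ∑ b, p a b * Real.logb 2 (p a b / ((∑ b', p a b') * (∑ a', p a' b)))

/-- Conditional mutual information `I(α; β | γ)` (in bits) of a joint pmf. -/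
def condMutualInfo {α β γ : Type*} [Fintype α] [Fintype β] [Fintype γ]
    (p : α → β → γ → ℝ) : ℝ :=
  ∑ a, ∑ b, ∑ c, p a b c *
    Real.logb 2 ((p a b c * (∑ a', ∑ b', p a' b' c)) /
      ((∑ b', p a b' c) * (∑ a', p a' b c)))

/-- The data of a source coding problem with action-dependent side information: a source pmf
(zero-probability letters removed), the channel `W x a y = P(y | x, a)` producing the side
information, a distortion function and an action cost function. -/
structure ActionSource (X Y A Xh : Type*) [Fintype X] [Fintype Y] where
  pX : X → ℝ
  pX_pos : ∀ x, 0 < pX x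
  pX_sum : ∑ x, pX x = 1
  W : X → A → Y → ℝ
  W_nonneg : ∀ x a y, 0 ≤ W x a y
  W_sum : ∀ x a, ∑ y, W x a y = 1
  dist : X → Xh → ℝ
  dist_nonneg : ∀ x xh, 0 ≤ dist x xh
  dist_zero : ∀ x, ∃ xh, dist x xh = 0
  cost : A → ℝ
  cost_nonneg : ∀ a, 0 ≤ cost a
  cost_zero : ∃ a, cost a = 0

/-- Shannon strategies `t`: a reconstruction letter `t.1 y` for every side information letter `y`,
together with an action `t.2`. -/
abbrev Strategy (Y A Xh : Type*) : Type _ := (Y → Xh) × A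

namespace ActionSource

variable {X Y A Xh U : Type*} [Fintype X] [Fintype Y] [Fintype A] [Fintype Xh] [Fintype U]
  [DecidableEq Y] [DecidableEq A]

/-- `P(x, y, u)` when `U` is drawn through the kernel `K` and the action is `A = η(U)`. -/
def joint (M : ActionSource X Y A Xh) (η : U → A) (K : X → U → ℝ) (x : X) (y : Y) (u : U) : ℝ :=
  M.pX x * K x u * M.W x (η u) y

/-- `P(x, y, a, u)`, the pmf of `joint` together with `A = η(U)`. -/
def jointA (M : ActionSource X Y A Xh) (η : U → A) (K : X → U → ℝ)
    (x : X) (y : Y) (a : A) (u : U) : ℝ :=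
  M.pX x * K x u * (if η u = a then 1 else 0) * M.W x a y

/-- `I(X; A) + I(X; U | Y, A)` with `A = η(U)`. -/
def rate (M : ActionSource X Y A Xh) (η : U → A) (K : X → U → ℝ) : ℝ :=
  mutualInfo (fun x a => ∑ y, ∑ u, M.jointA η K x y a u) +
    condMutualInfo (fun x u (ya : Y × A) => M.jointA η K x ya.1 ya.2 u)

/-- `E[d(X, φ(U, Y))]`. -/
def expDist (M : ActionSource X Y A Xh) (η : U → A) (K : X → U → ℝ) (φ : U → Y → Xh) : ℝ :=
  ∑ u, ∑ x, ∑ y, M.joint η K x y u * M.dist x (φ u y)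

/-- `E[Δ(A)]`. -/
def expCost (M : ActionSource X Y A Xh) (η : U → A) (K : X → U → ℝ) : ℝ :=
  ∑ u, ∑ x, M.pX x * K x u * M.cost (η u)

/-- `φ(u, y)` minimizes `E[d(X, xh) | U = u, Y = y]` over `xh` (written before normalization by
`P(u, y)`; where `P(u, y) = 0` every letter is a minimizer and the choice is immaterial). -/
def IsBestEstimate (M : ActionSource X Y A Xh) (η : U → A) (K : X → U → ℝ)
    (φ : U → Y → Xh) : Prop :=
  ∀ u y xh, ∑ x, M.joint η K x y u * M.dist x (φ u y) ≤ ∑ x, M.joint η K x y u * M.dist x xh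

/-- The values `I(X; A) + I(X; U | Y, A)` over all finite auxiliary alphabets, kernels `P(u | x)`
and maps `A = η(U)` that meet the distortion constraint `D` and the cost constraint `C`. -/
def rateSet (M : ActionSource X Y A Xh) (D C : ℝ) : Set ℝ :=
  {r | ∃ (n : ℕ) (K : X → Fin n → ℝ) (η : Fin n → A) (φ : Fin n → Y → Xh),
    IsKernel K ∧ M.IsBestEstimate η K φ ∧ M.expDist η K φ ≤ D ∧ M.expCost η K ≤ C ∧
      r = M.rate η K}

/-- The rate-distortion-cost function `R(D, C)`. -/
def rdc (M : ActionSource X Y A Xh) (D C : ℝ) : ℝ := sInf (M.rateSet D C)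

/-! ### Shannon strategies -/

/-- `I(X; a(T)) + I(X; T | Y, a(T))` for `K x t = P(t | x)`. -/
def stratRate (M : ActionSource X Y A Xh) (K : X → Strategy Y A Xh → ℝ) : ℝ :=
  M.rate Prod.snd K

/-- `E[d(X, T(Y))]`. -/
def stratDist (M : ActionSource X Y A Xh) (K : X → Strategy Y A Xh → ℝ) : ℝ :=
  M.expDist Prod.snd K Prod.fst

/-- `E[Δ(a(T))]`. -/
def stratCost (M : ActionSource X Y A Xh) (K : X → Strategy Y A Xh → ℝ) : ℝ :=
  M.expCost Prod.snd K

/-- `I(X; a(T)) + I(X; T | Y, a(T)) - s E[d(X, T(Y))] - m E[Δ(a(T))]`. -/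
def objective (M : ActionSource X Y A Xh) (s m : ℝ) (K : X → Strategy Y A Xh → ℝ) : ℝ :=
  M.stratRate K - s * M.stratDist K - m * M.stratCost K

/-- `Q_A(a)`, the marginal of the action. -/
def QA (M : ActionSource X Y A Xh) (K : X → Strategy Y A Xh → ℝ) (a : A) : ℝ :=
  ∑ x, ∑ t : Strategy Y A Xh with t.2 = a, M.pX x * K x t

/-- `Q_{T,Y}(t, y)`, the marginal of strategy and side information. -/
def QTY (M : ActionSource X Y A Xh) (K : X → Strategy Y A Xh → ℝ)
    (t : Strategy Y A Xh) (y : Y) : ℝ :=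
  ∑ x, M.pX x * M.W x t.2 y * K x t

/-- `P_{Y,A}(y, a)`. -/
def pYA (M : ActionSource X Y A Xh) (K : X → Strategy Y A Xh → ℝ) (y : Y) (a : A) : ℝ :=
  ∑ x, ∑ t : Strategy Y A Xh with t.2 = a, M.joint Prod.snd K x y t

/-- The function `F(P_{T|X}, Q_{T,Y}, Q_A)`, in bits. It is used only for `Q_A`, `Q_{T,Y}` that
vanish nowhere the pmf in the corresponding numerator can be positive. -/
def F (M : ActionSource X Y A Xh) (s m : ℝ) (K : X → Strategy Y A Xh → ℝ)
    (qTY : Strategy Y A Xh → Y → ℝ) (qA : A → ℝ) : ℝ :=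
  (∑ y, ∑ a, M.pYA K y a * Real.logb 2 (M.pYA K y a / qA a))
    - (∑ x, ∑ y, ∑ t : Strategy Y A Xh,
        M.joint Prod.snd K x y t * Real.logb 2 (M.W x t.2 y))
    + (∑ x, M.pX x * ∑ y, ∑ t : Strategy Y A Xh,
        (K x t * M.W x t.2 y) * Real.logb 2 ((K x t * M.W x t.2 y) / qTY t y))
    - s * M.stratDist K - m * M.stratCost K

/-! ### The inner algorithm: minimization of `F` over `P_{T|X}` -/

/-- `α_{t,x}`. -/
def alphaT (M : ActionSource X Y A Xh) (s m : ℝ) (qTY : Strategy Y A Xh → Y → ℝ) (qA : A → ℝ)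
    (t : Strategy Y A Xh) (x : X) : ℝ :=
  qA t.2 * (2 : ℝ) ^ (m * M.cost t.2) *
    (2 : ℝ) ^ (∑ y, M.W x t.2 y * (s * M.dist x (t.1 y) + Real.logb 2 (qTY t y)))

/-- `α_{a,x}`. -/
def alphaA (M : ActionSource X Y A Xh) (s m : ℝ) (qTY : Strategy Y A Xh → Y → ℝ) (qA : A → ℝ)
    (a : A) (x : X) : ℝ :=
  ∑ t : Strategy Y A Xh with t.2 = a, M.alphaT s m qTY qA t x

/-- The right-hand side `h` of the stationarity equations `P(a | x) = h_{a|x}(P_{A|X}, μ_x)`. -/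
def hMap (M : ActionSource X Y A Xh) (s m : ℝ) (qTY : Strategy Y A Xh → Y → ℝ) (qA : A → ℝ)
    (μ : X → ℝ) (P : X → A → ℝ) (x : X) (a : A) : ℝ :=
  ((2 : ℝ) ^ μ x * M.alphaA s m qTY qA a x) /
    ∏ y, (∑ x', M.pX x' * M.W x' a y * P x' a) ^ M.W x a y

/-- The damped map `g = P^β h^(1-β)`. -/
def gMap (M : ActionSource X Y A Xh) (s m β : ℝ) (qTY : Strategy Y A Xh → Y → ℝ) (qA : A → ℝ)
    (μ : X → ℝ) (P : X → A → ℝ) (x : X) (a : A) : ℝ :=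
  P x a ^ β * M.hMap s m qTY qA μ P x a ^ (1 - β)

/-- `h` in log coordinates `q = log₂ P`. -/
def logH (M : ActionSource X Y A Xh) (s m : ℝ) (qTY : Strategy Y A Xh → Y → ℝ) (qA : A → ℝ)
    (μ : X → ℝ) (q : X → A → ℝ) : X → A → ℝ :=
  fun x a => Real.logb 2 (M.hMap s m qTY qA μ (fun x' a' => (2 : ℝ) ^ q x' a') x a)

/-- `g` in log coordinates `q = log₂ P`. -/
def logG (M : ActionSource X Y A Xh) (s m β : ℝ) (qTY : Strategy Y A Xh → Y → ℝ) (qA : A → ℝ)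
    (μ : X → ℝ) (q : X → A → ℝ) : X → A → ℝ :=
  fun x a => Real.logb 2 (M.gMap s m β qTY qA μ (fun x' a' => (2 : ℝ) ^ q x' a') x a)

/-- The state `(μ⁽ⁱ⁾, P⁽ⁱ⁾_{A|X})` of the inner algorithm. In every round the fixed-point iteration
for `g` is run from the current `P_{A|X}` to its limit; then `μ` makes a subgradient step. The
successive step sizes are `1, 1/2, 1/3, …`. -/
def dualIter (M : ActionSource X Y A Xh) (s m β : ℝ) (qTY : Strategy Y A Xh → Y → ℝ)
    (qA : A → ℝ) : ℕ → (X → ℝ) × (X → A → ℝ)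
  | 0 => (fun _ => 1, fun _ _ => 1 / (Fintype.card (Strategy Y A Xh) : ℝ))
  | i + 1 =>
    let μ := (M.dualIter s m β qTY qA i).1
    let P := (M.dualIter s m β qTY qA i).2
    let P' := limUnder atTop (fun k : ℕ => (M.gMap s m β qTY qA μ)^[k] P)
    (fun x => μ x + (1 / ((i : ℝ) + 1)) / M.pX x * (1 - ∑ a, P' x a), P')

/-- The limit `P_{A|X}` of the inner algorithm. -/
def dualLimit (M : ActionSource X Y A Xh) (s m β : ℝ) (qTY : Strategy Y A Xh → Y → ℝ)
    (qA : A → ℝ) : X → A → ℝ :=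
  limUnder atTop (fun i => (M.dualIter s m β qTY qA i).2)

/-- The output `P_{T|X}` of the inner algorithm. -/
def innerOutput (M : ActionSource X Y A Xh) (s m β : ℝ) (qTY : Strategy Y A Xh → Y → ℝ)
    (qA : A → ℝ) (x : X) (t : Strategy Y A Xh) : ℝ :=
  M.alphaT s m qTY qA t x / M.alphaA s m qTY qA t.2 x * M.dualLimit s m β qTY qA x t.2

/-! ### The outer algorithm -/

/-- The kernel `P_{T|X}` after `k` rounds of the outer algorithm started at `K₀`. -/
def baIter (M : ActionSource X Y A Xh) (s m β : ℝ) (K₀ : X → Strategy Y A Xh → ℝ) :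
    ℕ → X → Strategy Y A Xh → ℝ
  | 0 => K₀
  | k + 1 =>
    M.innerOutput s m β (M.QTY (M.baIter s m β K₀ k)) (M.QA (M.baIter s m β K₀ k))

/-- The rate computed at the end of round `k + 1` of the outer algorithm,
`s D + m C + F(P_{T|X}, Q_{T,Y}, Q_A)` at the current `P_{T|X}`, `Q_{T,Y}`, `Q_A`. -/
def baRate (M : ActionSource X Y A Xh) (s m β : ℝ) (K₀ : X → Strategy Y A Xh → ℝ) (k : ℕ) : ℝ :=
  s * M.stratDist (M.baIter s m β K₀ (k + 1)) + m * M.stratCost (M.baIter s m β K₀ (k + 1)) +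
    M.F s m (M.baIter s m β K₀ (k + 1)) (M.QTY (M.baIter s m β K₀ k)) (M.QA (M.baIter s m β K₀ k))

end ActionSource

end

set_option linter.unusedSectionVars false

/-! ### Relative entropy inequalities -/

theorem sq_sqrt_sub_le_mul_logb {p q : ℝ} (hp : 0 ≤ p) (hq : 0 ≤ q) (h : q = 0 → p = 0) :
    (√p - √q) ^ 2 + (p - q) ≤ Real.log 2 * (p * (Real.logb 2 p - Real.logb 2 q)) := by
  have h2 : 0 < Real.log 2 := Real.log_pos one_lt_two
  rcases hp.eq_or_lt with rfl | hp
  · simp [Real.sq_sqrt hq]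
  have hq : 0 < q := hq.lt_of_ne fun h0 => hp.ne' (h h0.symm)
  have e : Real.log 2 * (p * (Real.logb 2 p - Real.logb 2 q)) = 2 * p * (-Real.log (√q / √p)) := by
    rw [Real.log_div (by positivity) (by positivity), Real.log_sqrt hq.le, Real.log_sqrt hp.le,
      Real.logb, Real.logb]
    field_simp
    ring
  rw [e]
  have h3 := Real.log_le_sub_one_of_pos (show 0 < √q / √p by positivity)
  have h4 : p * (√q / √p) = √p * √q := by
    nth_rw 1 [← Real.mul_self_sqrt hp.le]
    field_simp
  nlinarith [Real.sq_sqrt hp.le, Real.sq_sqrt hq.le]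

theorem sub_le_mul_logb {p q : ℝ} (hp : 0 ≤ p) (hq : 0 ≤ q) (h : q = 0 → p = 0) :
    p - q ≤ Real.log 2 * (p * (Real.logb 2 p - Real.logb 2 q)) :=
  le_trans (by nlinarith [sq_nonneg (√p - √q)]) (sq_sqrt_sub_le_mul_logb hp hq h)

theorem sum_sq_sqrt_sub_le {ι : Type*} (s : Finset ι) {p q : ι → ℝ} (hp : ∀ i ∈ s, 0 ≤ p i)
    (hq : ∀ i ∈ s, 0 ≤ q i) (h : ∀ i ∈ s, q i = 0 → p i = 0)
    (hs : ∑ i ∈ s, p i = ∑ i ∈ s, q i) :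
    ∑ i ∈ s, (√(p i) - √(q i)) ^ 2 ≤
      Real.log 2 * ∑ i ∈ s, p i * (Real.logb 2 (p i) - Real.logb 2 (q i)) := by
  have := Finset.sum_le_sum fun i hi => sq_sqrt_sub_le_mul_logb (hp i hi) (hq i hi) (h i hi)
  rw [Finset.sum_add_distrib, Finset.sum_sub_distrib, hs, sub_self, add_zero] at this
  rwa [Finset.mul_sum]

/-- Nonnegativity of the relative entropy. -/
theorem sum_mul_logb_sub_nonneg {ι : Type*} (s : Finset ι) {p q : ι → ℝ} (hp : ∀ i ∈ s, 0 ≤ p i)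
    (hq : ∀ i ∈ s, 0 ≤ q i) (h : ∀ i ∈ s, q i = 0 → p i = 0)
    (hs : ∑ i ∈ s, p i = ∑ i ∈ s, q i) :
    0 ≤ ∑ i ∈ s, p i * (Real.logb 2 (p i) - Real.logb 2 (q i)) := by
  have h1 := sum_sq_sqrt_sub_le s hp hq h hs
  have h2 : 0 ≤ ∑ i ∈ s, (√(p i) - √(q i)) ^ 2 := Finset.sum_nonneg fun i _ => sq_nonneg _
  exact nonneg_of_mul_nonneg_right (h2.trans h1) (Real.log_pos one_lt_two)

/-- The log-sum inequality. -/
theorem log_sum_inequality {ι : Type*} (s : Finset ι) {p q : ι → ℝ} (hp : ∀ i ∈ s, 0 ≤ p i)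
    (hq : ∀ i ∈ s, 0 ≤ q i) (h : ∀ i ∈ s, q i = 0 → p i = 0) :
    (∑ i ∈ s, p i) * (Real.logb 2 (∑ i ∈ s, p i) - Real.logb 2 (∑ i ∈ s, q i)) ≤
      ∑ i ∈ s, p i * (Real.logb 2 (p i) - Real.logb 2 (q i)) := by
  have h2 : 0 < Real.log 2 := Real.log_pos one_lt_two
  rcases (Finset.sum_nonneg hp).eq_or_lt with h0 | hP
  · have := (Finset.sum_eq_zero_iff_of_nonneg hp).1 h0.symm
    rw [← h0, zero_mul]
    exact (Finset.sum_eq_zero fun i hi => by rw [this i hi, zero_mul]).ge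
  obtain ⟨j, hj, hpj⟩ : ∃ j ∈ s, p j ≠ 0 := by
    by_contra! hc
    exact hP.ne' (Finset.sum_eq_zero hc)
  have hqj : 0 < q j := (hq j hj).lt_of_ne fun h0 => hpj (h j hj h0.symm)
  have hQ : 0 < ∑ i ∈ s, q i := Finset.sum_pos' hq ⟨j, hj, hqj⟩
  set P := ∑ i ∈ s, p i with hPdef
  set Q := ∑ i ∈ s, q i with hQdef
  have hterm : ∀ i ∈ s, p i * Real.log 2 * (Real.logb 2 P - Real.logb 2 Q) + (p i - q i * (P / Q)) ≤
      Real.log 2 * (p i * (Real.logb 2 (p i) - Real.logb 2 (q i))) := by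
    intro i hi
    by_cases hqi : q i = 0
    · simp [h i hi hqi, hqi]
    have hqi' := (hq i hi).lt_of_ne' hqi
    have := sub_le_mul_logb (hp i hi) (show 0 ≤ q i * (P / Q) by positivity)
      (fun h0 => absurd h0 (by positivity))
    rw [Real.logb_mul hqi (by positivity), Real.logb_div hP.ne' hQ.ne'] at this
    linarith
  have hsum := Finset.sum_le_sum hterm
  rw [Finset.sum_add_distrib, Finset.sum_sub_distrib, ← Finset.sum_mul, ← Finset.sum_mul,
    ← Finset.sum_mul, ← Finset.mul_sum, ← hPdef, ← hQdef, mul_div_cancel₀ _ hQ.ne', sub_self,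
    add_zero, mul_comm P, mul_assoc] at hsum
  exact le_of_mul_le_mul_left hsum h2

theorem continuous_mul_logb_two : Continuous fun v : ℝ => v * Real.logb 2 v := by
  have : (fun v : ℝ => v * Real.logb 2 v) = fun v => v * Real.log v / Real.log 2 := by
    ext v
    rw [Real.logb, mul_div_assoc]
  rw [this]
  exact Real.continuous_mul_log.div_const _

/-- The tangent inequality of the log-sum-exp function. -/
theorem logb_sum_sub_le {ι : Type*} (s : Finset ι) {w : ι → ℝ} (hw : ∀ i ∈ s, 0 ≤ w i)
    (hpos : ∃ i ∈ s, 0 < w i) (q q' : ι → ℝ) :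
    Real.logb 2 (∑ i ∈ s, w i * 2 ^ q i) - Real.logb 2 (∑ i ∈ s, w i * 2 ^ q' i) ≤
      ∑ i ∈ s, w i * 2 ^ q i / (∑ j ∈ s, w j * 2 ^ q j) * (q i - q' i) := by
  have hS : ∀ r : ι → ℝ, 0 < ∑ i ∈ s, w i * 2 ^ r i := fun r => by
    obtain ⟨i, hi, hwi⟩ := hpos
    exact Finset.sum_pos' (fun j hj => mul_nonneg (hw j hj) (by positivity)) ⟨i, hi, by positivity⟩
  have hl := log_sum_inequality s (p := fun i => w i * 2 ^ q i) (q := fun i => w i * 2 ^ q' i)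
    (fun i hi => mul_nonneg (hw i hi) (by positivity))
    (fun i hi => mul_nonneg (hw i hi) (by positivity))
    (fun i hi h0 => by
      rcases mul_eq_zero.1 h0 with h0 | h0
      · rw [h0, zero_mul]
      · exact absurd h0 (by positivity))
  have he : ∑ i ∈ s, w i * 2 ^ q i / (∑ j ∈ s, w j * 2 ^ q j) * (q i - q' i) =
      (∑ i ∈ s, w i * 2 ^ q i *
        (Real.logb 2 (w i * 2 ^ q i) - Real.logb 2 (w i * 2 ^ q' i))) /
        ∑ j ∈ s, w j * 2 ^ q j := by
    rw [Finset.sum_div]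
    refine Finset.sum_congr rfl fun i hi => ?_
    rcases (hw i hi).eq_or_lt with h0 | h0
    · simp [← h0]
    · rw [Real.logb_mul h0.ne' (by positivity), Real.logb_mul h0.ne' (by positivity),
        Real.logb_rpow two_pos (by norm_num), Real.logb_rpow two_pos (by norm_num)]
      ring
  rw [he, le_div_iff₀ (hS q), mul_comm]
  exact hl

theorem one_add_mul_log_le_two_rpow (u : ℝ) : 1 + u * Real.log 2 ≤ (2 : ℝ) ^ u := by
  rw [Real.rpow_def_of_pos two_pos]
  linarith [Real.add_one_le_exp (Real.log 2 * u)]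

theorem two_rpow_sub_le (u v : ℝ) : (2 : ℝ) ^ u - 2 ^ v ≤ 2 ^ u * (Real.log 2 * (u - v)) := by
  have h := one_add_mul_log_le_two_rpow (v - u)
  have e : (2 : ℝ) ^ v = 2 ^ u * 2 ^ (v - u) := by
    rw [← Real.rpow_add two_pos]; congr 1; ring
  rw [e]
  nlinarith [Real.rpow_pos_of_pos (two_pos : (0 : ℝ) < 2) u]

/-- Strong monotonicity of `2 ^ u` on a half line. -/
theorem mul_sq_le_mul_two_rpow_sub {c u v : ℝ} (hu : c ≤ u) (hv : c ≤ v) :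
    2 ^ c * Real.log 2 * (u - v) ^ 2 ≤ (u - v) * ((2 : ℝ) ^ u - 2 ^ v) := by
  have h2 : 0 < Real.log 2 := Real.log_pos one_lt_two
  wlog huv : v ≤ u generalizing u v
  · have := this hv hu (le_of_not_ge huv)
    nlinarith
  have h := two_rpow_sub_le v u
  have hc : (2 : ℝ) ^ c ≤ 2 ^ v := Real.rpow_le_rpow_of_exponent_le one_le_two hv
  have h3 : 2 ^ c * (Real.log 2 * (u - v)) ≤ 2 ^ v * (Real.log 2 * (u - v)) :=
    mul_le_mul_of_nonneg_right hc (mul_nonneg h2.le (by linarith))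
  nlinarith

/-- `2 ^ u` is Lipschitz on a half line. -/
theorem abs_two_rpow_sub_le {c u v : ℝ} (hu : u ≤ c) (hv : v ≤ c) :
    |(2 : ℝ) ^ u - 2 ^ v| ≤ 2 ^ c * Real.log 2 * |u - v| := by
  have h2 : 0 < Real.log 2 := Real.log_pos one_lt_two
  wlog huv : v ≤ u generalizing u v
  · rw [abs_sub_comm, abs_sub_comm u]
    exact this hv hu (le_of_not_ge huv)
  rw [abs_of_nonneg (sub_nonneg.2 huv),
    abs_of_nonneg (sub_nonneg.2 (Real.rpow_le_rpow_of_exponent_le one_le_two huv))]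
  have hc : (2 : ℝ) ^ u ≤ 2 ^ c := Real.rpow_le_rpow_of_exponent_le one_le_two hu
  have h3 : 2 ^ u * (Real.log 2 * (u - v)) ≤ 2 ^ c * (Real.log 2 * (u - v)) :=
    mul_le_mul_of_nonneg_right hc (mul_nonneg h2.le (by linarith))
  linarith [two_rpow_sub_le u v]

/-! ### Fixed points and stochastic approximation -/

/-- A continuous self-map of a compact set that decreases some continuous gauge of the displacement
has a fixed point. -/
theorem IsCompact.exists_fixedPoint {E : Type*} [TopologicalSpace E] {s : Set E} (hs : IsCompact s)
    (hne : s.Nonempty) {f : E → E} (hf : Set.MapsTo f s s) (hfc : ContinuousOn f s)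
    {D : E × E → ℝ} (hD : Continuous D)
    (hlt : ∀ x ∈ s, f x ≠ x → D (f x, f (f x)) < D (x, f x)) : ∃ x ∈ s, f x = x := by
  obtain ⟨x, hx, hmin⟩ := hs.exists_isMinOn hne
    (hD.comp_continuousOn (continuousOn_id.prodMk hfc))
  refine ⟨x, hx, ?_⟩
  by_contra hne
  exact absurd (hmin (hf hx)) (not_le.2 (hlt x hx hne))

/-- The Robbins-Monro recursion with steps `1 / (i + 1)`. -/
theorem tendsto_zero_of_le_sub_add {V : ℕ → ℝ} {c B : ℝ} (hV : ∀ i, 0 ≤ V i) (hc : 0 < c)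
    (h : ∀ i : ℕ, V (i + 1) ≤ V i - c * (1 / ((i : ℝ) + 1)) * V i + B * (1 / ((i : ℝ) + 1)) ^ 2) :
    Tendsto V atTop (𝓝 0) := by
  set θ : ℕ → ℝ := fun i => 1 / ((i : ℝ) + 1) with hθ
  have hθpos : ∀ i, 0 < θ i := fun i => by simp only [hθ]; positivity
  have hns : ¬ Summable θ := by
    have := Real.not_summable_one_div_natCast
    rw [← summable_nat_add_iff 1] at this
    simpa [hθ] using this
  have hs2 : Summable fun i => θ i ^ 2 := by
    have := (summable_nat_add_iff 1).2 (Real.summable_one_div_nat_pow.2 (one_lt_two))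
    simpa [hθ, div_pow] using this
  have hsum : ∀ n, V n + ∑ i ∈ Finset.range n, c * θ i * V i =
      V 0 + ∑ i ∈ Finset.range n, (V (i + 1) - V i + c * θ i * V i) := by
    intro n
    rw [Finset.sum_add_distrib, Finset.sum_range_sub]
    ring
  set e : ℕ → ℝ := fun i => B * θ i ^ 2 - (V (i + 1) - V i + c * θ i * V i) with he
  have he0 : ∀ i, 0 ≤ e i := fun i => by simp only [he]; linarith [h i]
  have hx0 : ∀ i, 0 ≤ c * θ i * V i := fun i =>
    mul_nonneg (mul_nonneg hc.le (hθpos i).le) (hV i)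
  have hbal : ∀ n, V n + ∑ i ∈ Finset.range n, (c * θ i * V i + e i) =
      V 0 + ∑ i ∈ Finset.range n, B * θ i ^ 2 := by
    intro n
    have h1 := hsum n
    have h2 : ∑ i ∈ Finset.range n, e i = ∑ i ∈ Finset.range n, B * θ i ^ 2 -
        ∑ i ∈ Finset.range n, (V (i + 1) - V i + c * θ i * V i) := by
      rw [← Finset.sum_sub_distrib]
    rw [Finset.sum_add_distrib]
    linarith
  have hB := (hs2.mul_left B).hasSum.tendsto_sum_nat
  obtain ⟨b, hb⟩ := hB.bddAbove_range
  have hsumm : Summable fun i => c * θ i * V i + e i := by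
    refine summable_of_sum_range_le (c := V 0 + b) (fun i => add_nonneg (hx0 i) (he0 i)) fun n => ?_
    have := hb ⟨n, rfl⟩
    simp only at this
    linarith [hbal n, hV n]
  have hxs : Summable fun i => c * θ i * V i :=
    hsumm.of_nonneg_of_le hx0 fun i => by linarith [he0 i]
  have hVt : Tendsto V atTop (𝓝 (V 0 + ∑' i, B * θ i ^ 2 - ∑' i, (c * θ i * V i + e i))) := by
    have := (hB.const_add (V 0)).sub hsumm.hasSum.tendsto_sum_nat
    refine this.congr fun n => ?_
    linarith [hbal n]
  set v := V 0 + ∑' i, B * θ i ^ 2 - ∑' i, (c * θ i * V i + e i)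
  have hv0 : 0 ≤ v := ge_of_tendsto' hVt hV
  rcases hv0.eq_or_lt with hv | hv
  · rwa [hv]
  exfalso
  apply hns
  obtain ⟨N, hN⟩ := eventually_atTop.1 (hVt.eventually (lt_mem_nhds (half_lt_self hv)))
  rw [← summable_nat_add_iff N] at hxs ⊢
  refine (hxs.mul_left (2 / (c * v))).of_nonneg_of_le (fun i => (hθpos _).le) fun i => ?_
  have h1 := hN (i + N) (by omega)
  have h2 := hθpos (i + N)
  calc θ (i + N) = 2 / (c * v) * (c * θ (i + N) * (v / 2)) := by field_simp
    _ ≤ 2 / (c * v) * (c * θ (i + N) * V (i + N)) := by gcongr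

theorem Finite.exists_pos_forall_le {ι : Type*} [Finite ι] {f : ι → ℝ} (hf : ∀ i, 0 < f i) :
    ∃ δ, 0 < δ ∧ ∀ i, δ ≤ f i := by
  cases isEmpty_or_nonempty ι
  · exact ⟨1, one_pos, fun i => isEmptyElim i⟩
  · obtain ⟨i, hi⟩ := Finite.exists_min f
    exact ⟨f i, hf i, hi⟩

namespace ActionSource

variable {X Y A Xh : Type*} [Fintype X] [Fintype Y] [Fintype A] [Fintype Xh]
  [DecidableEq Y] [DecidableEq A] (M : ActionSource X Y A Xh)

/-! ### The fixed-point iteration -/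

theorem nonempty_source (M : ActionSource X Y A Xh) : Nonempty X := by
  by_contra h
  rw [not_nonempty_iff] at h
  have := M.pX_sum
  simp at this

theorem pX_le_one (x : X) : M.pX x ≤ 1 :=
  M.pX_sum ▸ Finset.single_le_sum (fun x _ => (M.pX_pos x).le) (Finset.mem_univ x)

theorem W_le_one (x : X) (a : A) (y : Y) : M.W x a y ≤ 1 :=
  M.W_sum x a ▸ Finset.single_le_sum (fun y _ => M.W_nonneg x a y) (Finset.mem_univ y)

theorem pX_mul_W_nonneg (x : X) (a : A) (y : Y) : 0 ≤ M.pX x * M.W x a y :=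
  mul_nonneg (M.pX_pos x).le (M.W_nonneg x a y)

/-- The logarithm of the (unnormalized) output `P(y, a)` of the channel, in log coordinates. -/
noncomputable def lse (q : X → A → ℝ) (a : A) (y : Y) : ℝ :=
  Real.logb 2 (∑ x, M.pX x * M.W x a y * 2 ^ q x a)

theorem output_pos {P : X → A → ℝ} (hP : ∀ x a, 0 < P x a) {x : X} {a : A} {y : Y}
    (h : 0 < M.W x a y) : 0 < ∑ x', M.pX x' * M.W x' a y * P x' a :=
  Finset.sum_pos' (fun x' _ => mul_nonneg (M.pX_mul_W_nonneg x' a y) (hP x' a).le)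
    ⟨x, Finset.mem_univ x, mul_pos (mul_pos (M.pX_pos x) h) (hP x a)⟩

theorem outputExp_pos (q : X → A → ℝ) {x : X} {a : A} {y : Y} (h : 0 < M.W x a y) :
    0 < ∑ x', M.pX x' * M.W x' a y * (2 : ℝ) ^ q x' a :=
  M.output_pos (P := fun x a => (2 : ℝ) ^ q x a) (fun _ _ => by positivity) h

theorem outputExp_le {q : X → A → ℝ} {a : A} {hi : ℝ} (hq : ∀ x, q x a ≤ hi) (y : Y) :
    ∑ x, M.pX x * M.W x a y * (2 : ℝ) ^ q x a ≤ 2 ^ hi := by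
  calc ∑ x, M.pX x * M.W x a y * (2 : ℝ) ^ q x a ≤ ∑ x, M.pX x * 2 ^ hi := by
        refine Finset.sum_le_sum fun x _ => ?_
        have h1 : M.pX x * M.W x a y ≤ M.pX x :=
          mul_le_of_le_one_right (M.pX_pos x).le (M.W_le_one x a y)
        exact mul_le_mul h1 (Real.rpow_le_rpow_of_exponent_le one_le_two (hq x)) (by positivity)
          (M.pX_pos x).le
    _ = 2 ^ hi := by rw [← Finset.sum_mul, M.pX_sum, one_mul]

/-- Averaged differences of `lse` are dominated by an average of the coordinate differences, in
which the weight of the diagonal is bounded below on bounded sets. -/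
theorem exists_weights_lse_sub_le (q q' : X → A → ℝ) (x : X) (a : A) :
    ∃ S : X → ℝ, (∀ x', 0 ≤ S x') ∧ ∑ x', S x' = 1 ∧
      (∀ lo hi, (∀ x', lo ≤ q x' a ∧ q x' a ≤ hi) →
        M.pX x * 2 ^ (lo - hi) * ∑ y, M.W x a y ^ 2 ≤ S x) ∧
      ∑ y, M.W x a y * (M.lse q a y - M.lse q' a y) ≤ ∑ x', S x' * (q x' a - q' x' a) := by
  set Z : Y → ℝ := fun y => ∑ x', M.pX x' * M.W x' a y * (2 : ℝ) ^ q x' a with hZ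
  have hZ0 : ∀ y, 0 ≤ Z y := fun y =>
    Finset.sum_nonneg fun x' _ => mul_nonneg (M.pX_mul_W_nonneg x' a y) (by positivity)
  refine ⟨fun x' => ∑ y, M.W x a y * (M.pX x' * M.W x' a y * 2 ^ q x' a / Z y), fun x' => ?_, ?_,
    fun lo hi hq => ?_, ?_⟩
  · exact Finset.sum_nonneg fun y _ => mul_nonneg (M.W_nonneg x a y)
      (div_nonneg (mul_nonneg (M.pX_mul_W_nonneg x' a y) (by positivity)) (hZ0 y))
  · rw [Finset.sum_comm, ← M.W_sum x a]
    refine Finset.sum_congr rfl fun y _ => ?_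
    rw [← Finset.mul_sum, ← Finset.sum_div]
    rcases (M.W_nonneg x a y).eq_or_lt with h | h
    · rw [← h, zero_mul]
    · rw [div_self (M.outputExp_pos q h).ne', mul_one]
  · rw [Finset.mul_sum]
    refine Finset.sum_le_sum fun y _ => ?_
    rcases (M.W_nonneg x a y).eq_or_lt with h | h
    · simp [← h]
    have h1 : (2 : ℝ) ^ (lo - hi) ≤ 2 ^ q x a / Z y := by
      rw [Real.rpow_sub two_pos]
      exact div_le_div₀ (by positivity) (Real.rpow_le_rpow_of_exponent_le one_le_two (hq x).1)
        (M.outputExp_pos q h) (M.outputExp_le (fun x' => (hq x').2) y)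
    calc M.pX x * 2 ^ (lo - hi) * M.W x a y ^ 2
        = M.W x a y * (M.pX x * M.W x a y * 2 ^ (lo - hi)) := by ring
      _ ≤ M.W x a y * (M.pX x * M.W x a y * (2 ^ q x a / Z y)) :=
        mul_le_mul_of_nonneg_left (mul_le_mul_of_nonneg_left h1 (M.pX_mul_W_nonneg x a y)) h.le
      _ = _ := by rw [mul_div_assoc]
  · simp_rw [Finset.sum_mul]
    rw [Finset.sum_comm]
    refine Finset.sum_le_sum fun y _ => ?_
    rcases (M.W_nonneg x a y).eq_or_lt with h | h
    · simp [← h]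
    simp_rw [mul_assoc (M.W x a y)]
    rw [← Finset.mul_sum]
    exact mul_le_mul_of_nonneg_left (logb_sum_sub_le Finset.univ
      (fun x' _ => M.pX_mul_W_nonneg x' a y) ⟨x, Finset.mem_univ x, mul_pos (M.pX_pos x) h⟩
      (fun x' => q x' a) (fun x' => q' x' a)) h.le

variable {s m β : ℝ} {qTY : Strategy Y A Xh → Y → ℝ} {qA : A → ℝ}

theorem alphaT_pos (hqA : ∀ a, 0 < qA a) (t : Strategy Y A Xh) (x : X) :
    0 < M.alphaT s m qTY qA t x := by
  have := hqA t.2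
  unfold alphaT
  positivity

theorem nonempty_reproduction (M : ActionSource X Y A Xh) : Nonempty Xh :=
  have ⟨x⟩ := M.nonempty_source
  ⟨(M.dist_zero x).choose⟩

theorem nonempty_action (M : ActionSource X Y A Xh) : Nonempty A := ⟨M.cost_zero.choose⟩

theorem alphaA_pos (hqA : ∀ a, 0 < qA a) (a : A) (x : X) : 0 < M.alphaA s m qTY qA a x := by
  have ⟨xh⟩ := M.nonempty_reproduction
  exact Finset.sum_pos (fun t _ => M.alphaT_pos hqA t x) ⟨(fun _ => xh, a), by simp⟩

theorem hMap_pos (hqA : ∀ a, 0 < qA a) (μ : X → ℝ) {P : X → A → ℝ} (hP : ∀ x a, 0 < P x a)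
    (x : X) (a : A) : 0 < M.hMap s m qTY qA μ P x a := by
  unfold hMap
  refine div_pos (mul_pos (by positivity) (M.alphaA_pos hqA a x)) (Finset.prod_pos fun y _ => ?_)
  rcases (M.W_nonneg x a y).eq_or_lt with h | h
  · rw [← h, Real.rpow_zero]
    exact one_pos
  · exact Real.rpow_pos_of_pos (M.output_pos hP h) _

theorem gMap_pos (hqA : ∀ a, 0 < qA a) (μ : X → ℝ) {P : X → A → ℝ} (hP : ∀ x a, 0 < P x a)
    (x : X) (a : A) : 0 < M.gMap s m β qTY qA μ P x a :=
  mul_pos (Real.rpow_pos_of_pos (hP x a) _) (Real.rpow_pos_of_pos (M.hMap_pos hqA μ hP x a) _)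

theorem logb_hMap (hqA : ∀ a, 0 < qA a) (μ : X → ℝ) {P : X → A → ℝ} (hP : ∀ x a, 0 < P x a)
    (x : X) (a : A) :
    Real.logb 2 (M.hMap s m qTY qA μ P x a) = μ x + Real.logb 2 (M.alphaA s m qTY qA a x) -
      ∑ y, M.W x a y * Real.logb 2 (∑ x', M.pX x' * M.W x' a y * P x' a) := by
  have hne : ∀ y, (∑ x', M.pX x' * M.W x' a y * P x' a) ^ M.W x a y ≠ 0 := fun y => by
    rcases (M.W_nonneg x a y).eq_or_lt with h | h
    · rw [← h, Real.rpow_zero]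
      exact one_ne_zero
    · exact (Real.rpow_pos_of_pos (M.output_pos hP h) _).ne'
  have hα := (M.alphaA_pos (s := s) (m := m) (qTY := qTY) hqA a x).ne'
  unfold hMap
  rw [Real.logb_div (mul_ne_zero (by positivity) hα) (Finset.prod_ne_zero_iff.2 fun y _ => hne y),
    Real.logb_mul (by positivity) hα, Real.logb_rpow two_pos (by norm_num),
    Real.logb_prod _ _ fun y _ => hne y]
  congr 1
  refine Finset.sum_congr rfl fun y _ => ?_
  rcases (M.W_nonneg x a y).eq_or_lt with h | h
  · rw [← h, Real.rpow_zero, Real.logb_one, zero_mul]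
  · rw [Real.logb_rpow_eq_mul_logb_of_pos (M.output_pos hP h)]

theorem logH_apply (hqA : ∀ a, 0 < qA a) (μ : X → ℝ) (q : X → A → ℝ) (x : X) (a : A) :
    M.logH s m qTY qA μ q x a = μ x + Real.logb 2 (M.alphaA s m qTY qA a x) -
      ∑ y, M.W x a y * M.lse q a y :=
  M.logb_hMap hqA μ (P := fun x a => (2 : ℝ) ^ q x a) (fun _ _ => by positivity) x a

theorem logG_apply (hqA : ∀ a, 0 < qA a) (μ : X → ℝ) (q : X → A → ℝ) (x : X) (a : A) :
    M.logG s m β qTY qA μ q x a = β * q x a + (1 - β) * M.logH s m qTY qA μ q x a := by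
  have hh := M.hMap_pos (s := s) (m := m) (qTY := qTY) hqA μ
    (P := fun x a => (2 : ℝ) ^ q x a) (fun _ _ => by positivity) x a
  unfold logG gMap
  rw [Real.logb_mul (Real.rpow_pos_of_pos (by positivity) _).ne'
    (Real.rpow_pos_of_pos hh _).ne', Real.logb_rpow_eq_mul_logb_of_pos (by positivity),
    Real.logb_rpow_eq_mul_logb_of_pos hh, Real.logb_rpow two_pos (by norm_num)]
  rfl

theorem gMap_two_rpow (hqA : ∀ a, 0 < qA a) (μ : X → ℝ) (q : X → A → ℝ) :
    M.gMap s m β qTY qA μ (fun x a => (2 : ℝ) ^ q x a) =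
      fun x a => (2 : ℝ) ^ M.logG s m β qTY qA μ q x a := by
  ext x a
  rw [logG, Real.rpow_logb two_pos (by norm_num)
    (M.gMap_pos hqA μ (P := fun x a => (2 : ℝ) ^ q x a) (fun _ _ => by positivity) x a)]

theorem gMap_iterate_two_rpow (hqA : ∀ a, 0 < qA a) (μ : X → ℝ) (q : X → A → ℝ) (j : ℕ) :
    (M.gMap s m β qTY qA μ)^[j] (fun x a => (2 : ℝ) ^ q x a) =
      fun x a => (2 : ℝ) ^ (M.logG s m β qTY qA μ)^[j] q x a := by
  induction j with
  | zero => rfl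
  | succ j ih => rw [Function.iterate_succ_apply', Function.iterate_succ_apply', ih,
      M.gMap_two_rpow hqA]

theorem logG_eq_self_iff (hqA : ∀ a, 0 < qA a) (hβ1 : β < 1) (μ : X → ℝ) (q : X → A → ℝ) :
    M.logG s m β qTY qA μ q = q ↔ M.logH s m qTY qA μ q = q := by
  simp only [funext_iff, M.logG_apply hqA]
  refine forall₂_congr fun x a => ?_
  have : 0 < 1 - β := by linarith
  constructor
  · intro h
    apply mul_left_cancel₀ this.ne'
    linarith
  · intro h
    rw [h]
    ring

/-- `g` in log coordinates is a contraction on every box. -/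
theorem exists_contraction_logG (hqA : ∀ a, 0 < qA a) (hβ0 : 0 < β) (hβ1 : β < 1) (lo hi : ℝ) :
    ∃ L : NNReal, L < 1 ∧ ∀ (μ : X → ℝ) (q q' : X → A → ℝ),
      (∀ x a, lo ≤ q x a ∧ q x a ≤ hi) → (∀ x a, lo ≤ q' x a ∧ q' x a ≤ hi) →
      Dist.dist (M.logG s m β qTY qA μ q) (M.logG s m β qTY qA μ q') ≤ L * Dist.dist q q' := by
  obtain ⟨δ, hδ, hle⟩ := Finite.exists_pos_forall_le
    (f := fun z : X × A => M.pX z.1 * 2 ^ (lo - hi) * ∑ y, M.W z.1 z.2 y ^ 2) (fun z => by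
      refine mul_pos (mul_pos (M.pX_pos _) (by positivity)) ?_
      refine (Finset.sum_nonneg fun y _ => sq_nonneg _).lt_of_ne' fun h0 => ?_
      rw [Finset.sum_eq_zero_iff_of_nonneg fun y _ => sq_nonneg _] at h0
      have := M.W_sum z.1 z.2
      rw [Finset.sum_eq_zero fun y hy => pow_eq_zero_iff two_ne_zero |>.1 (h0 y hy)] at this
      exact zero_ne_one this)
  set L : ℝ := max 0 (max (1 - 2 * β) (1 - 2 * (1 - β) * δ))
  have hL0 : 0 ≤ L := le_max_left _ _
  have h1β : 0 < 1 - β := by linarith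
  have hL1 : L < 1 := max_lt one_pos (max_lt (by linarith) (by nlinarith [mul_pos h1β hδ]))
  have key : ∀ (μ : X → ℝ) (q q' : X → A → ℝ), (∀ x a, lo ≤ q x a ∧ q x a ≤ hi) → ∀ x a,
      M.logG s m β qTY qA μ q' x a - M.logG s m β qTY qA μ q x a ≤ L * Dist.dist q q' := by
    intro μ q q' hq x a
    obtain ⟨S, hS0, hS1, hSx, hS⟩ := M.exists_weights_lse_sub_le q q' x a
    set d := Dist.dist q q'
    have hd : ∀ x', |q x' a - q' x' a| ≤ d := fun x' =>
      (dist_le_pi_dist (q x') (q' x') a).trans (dist_le_pi_dist q q' x')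
    have hd0 : 0 ≤ d := _root_.dist_nonneg
    have h1 := (hle (x, a)).trans (hSx lo hi fun x' => hq x' a)
    have h2 : S x * (d - (q x a - q' x a)) ≤ ∑ x', S x' * (d - (q x' a - q' x' a)) :=
      Finset.single_le_sum (f := fun x' => S x' * (d - (q x' a - q' x' a)))
        (fun x' _ => mul_nonneg (hS0 x') (by linarith [(abs_le.1 (hd x')).2])) (Finset.mem_univ x)
    simp only [mul_sub, Finset.sum_sub_distrib, ← Finset.sum_mul, hS1, one_mul] at h2
    simp only [mul_sub, Finset.sum_sub_distrib] at hS
    rw [M.logG_apply hqA, M.logG_apply hqA, M.logH_apply hqA, M.logH_apply hqA]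
    obtain ⟨hu1, hu2⟩ := abs_le.1 (hd x)
    set u := q x a - q' x a with hu
    have hq' : q' x a = q x a - u := by rw [hu]; ring
    rw [hq']
    have h3 : (∑ y, M.W x a y * M.lse q a y) - ∑ y, M.W x a y * M.lse q' a y ≤
      d - S x * d + S x * u := by
      rw [hu, mul_sub]
      linarith
    have h4 : β * (q x a - u) + (1 - β) * (μ x + Real.logb 2 (M.alphaA s m qTY qA a x) -
        ∑ y, M.W x a y * M.lse q' a y) - (β * q x a + (1 - β) * (μ x +
        Real.logb 2 (M.alphaA s m qTY qA a x) - ∑ y, M.W x a y * M.lse q a y)) ≤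
        (β - (1 - β) * S x) * (-u) + (1 - β) * (1 - S x) * d := by
      nlinarith [mul_le_mul_of_nonneg_left h3 h1β.le]
    refine h4.trans ?_
    rcases le_total 0 (β - (1 - β) * S x) with h5 | h5
    · have h6 : (1 - 2 * (1 - β) * δ) * d ≤ L * d :=
        mul_le_mul_of_nonneg_right ((le_max_right _ _).trans (le_max_right _ _)) hd0
      have h7 := mul_le_mul_of_nonneg_left (show -u ≤ d by linarith) h5
      have h8 := mul_le_mul_of_nonneg_right (mul_le_mul_of_nonneg_left h1 h1β.le) hd0
      nlinarith
    · have h6 : (1 - 2 * β) * d ≤ L * d :=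
        mul_le_mul_of_nonneg_right ((le_max_left _ _).trans (le_max_right _ _)) hd0
      have h7 := mul_le_mul_of_nonneg_left hu2 (neg_nonneg.2 h5)
      nlinarith
  refine ⟨⟨L, hL0⟩, hL1, fun μ q q' hq hq' => ?_⟩
  have hr : 0 ≤ L * Dist.dist q q' := mul_nonneg hL0 _root_.dist_nonneg
  refine (dist_pi_le_iff hr).2 fun x => (dist_pi_le_iff hr).2 fun a => ?_
  rw [Real.dist_eq, abs_le]
  constructor
  · linarith [key μ q q' hq x a]
  · rw [dist_comm]
    exact key μ q' q hq' x a

variable (s m qTY qA) in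
/-- The constant in the bound `H(q) ≤ μ + hBound - q`, where `H` is `h` in log coordinates. -/
noncomputable def hBound (x : X) (a : A) : ℝ :=
  Real.logb 2 (M.alphaA s m qTY qA a x) - ∑ y, M.W x a y * Real.logb 2 (M.pX x * M.W x a y)

theorem logH_le (hqA : ∀ a, 0 < qA a) (μ : X → ℝ) (q : X → A → ℝ) (x : X) (a : A) :
    M.logH s m qTY qA μ q x a ≤ μ x + M.hBound s m qTY qA x a - q x a := by
  have : ∑ y, M.W x a y * (Real.logb 2 (M.pX x * M.W x a y) + q x a) ≤
      ∑ y, M.W x a y * M.lse q a y := by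
    refine Finset.sum_le_sum fun y _ => ?_
    rcases (M.W_nonneg x a y).eq_or_lt with h | h
    · simp [← h]
    refine mul_le_mul_of_nonneg_left ?_ h.le
    have hpos : 0 < M.pX x * M.W x a y := mul_pos (M.pX_pos x) h
    have e : Real.logb 2 (M.pX x * M.W x a y) + q x a =
        Real.logb 2 (M.pX x * M.W x a y * 2 ^ q x a) := by
      rw [Real.logb_mul hpos.ne' (by positivity), Real.logb_rpow two_pos (by norm_num)]
    rw [e]
    exact Real.logb_le_logb_of_le one_lt_two (by positivity)
      (Finset.single_le_sum (f := fun x => M.pX x * M.W x a y * (2 : ℝ) ^ q x a)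
        (fun x' _ => mul_nonneg (M.pX_mul_W_nonneg x' a y) (by positivity)) (Finset.mem_univ x))
  simp_rw [mul_add] at this
  rw [Finset.sum_add_distrib, ← Finset.sum_mul, M.W_sum, one_mul] at this
  rw [M.logH_apply hqA, hBound]
  linarith

theorem le_logH (hqA : ∀ a, 0 < qA a) (μ : X → ℝ) {q : X → A → ℝ} {a : A} {hi : ℝ}
    (hq : ∀ x, q x a ≤ hi) (x : X) :
    μ x + Real.logb 2 (M.alphaA s m qTY qA a x) - hi ≤ M.logH s m qTY qA μ q x a := by
  have : ∑ y, M.W x a y * M.lse q a y ≤ ∑ y, M.W x a y * hi := by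
    refine Finset.sum_le_sum fun y _ => ?_
    rcases (M.W_nonneg x a y).eq_or_lt with h | h
    · simp [← h]
    refine mul_le_mul_of_nonneg_left ?_ h.le
    exact (Real.logb_le_iff_le_rpow one_lt_two (M.outputExp_pos q h)).2 (M.outputExp_le hq y)
  rw [← Finset.sum_mul, M.W_sum, one_mul] at this
  rw [M.logH_apply hqA]
  linarith

theorem logG_half (hqA : ∀ a, 0 < qA a) (μ : X → ℝ) (q : X → A → ℝ) (x : X) (a : A) :
    M.logG s m (1 / 2) qTY qA μ q x a = (q x a + M.logH s m qTY qA μ q x a) / 2 := by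
  rw [M.logG_apply hqA]
  ring

theorem exists_logH_eq_self (hqA : ∀ a, 0 < qA a) (μ : X → ℝ) :
    ∃ q, M.logH s m qTY qA μ q = q := by
  obtain ⟨hi, hhi⟩ := Finite.exists_le
    (fun z : X × A => (μ z.1 + M.hBound s m qTY qA z.1 z.2) / 2)
  obtain ⟨lo', hlo'⟩ := Finite.exists_ge
    (fun z : X × A => μ z.1 + Real.logb 2 (M.alphaA s m qTY qA z.2 z.1) - hi)
  set lo := min lo' hi
  have hlo : ∀ x a, lo ≤ μ x + Real.logb 2 (M.alphaA s m qTY qA a x) - hi := fun x a =>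
    (min_le_left _ _).trans (hlo' (x, a))
  obtain ⟨L, hL1, hL⟩ := M.exists_contraction_logG (s := s) (m := m) (qTY := qTY) hqA
    (β := 1 / 2) (by norm_num) (by norm_num) lo hi
  set B : Set (X → A → ℝ) := Set.Icc (fun _ _ => lo) (fun _ _ => hi)
  have hB : ∀ {q}, q ∈ B ↔ ∀ x a, lo ≤ q x a ∧ q x a ≤ hi := fun {q} =>
    ⟨fun h x a => ⟨h.1 x a, h.2 x a⟩, fun h => ⟨fun x a => (h x a).1, fun x a => (h x a).2⟩⟩
  have hmaps : Set.MapsTo (M.logG s m (1 / 2) qTY qA μ) B B := by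
    intro q hq
    rw [hB] at hq ⊢
    intro x a
    rw [M.logG_half hqA]
    have h1 := M.logH_le (s := s) (m := m) (qTY := qTY) hqA μ q x a
    have h2 := M.le_logH (s := s) (m := m) (qTY := qTY) hqA μ (fun x => (hq x a).2) x
    have h3 := hhi (x, a)
    dsimp only at h3
    constructor
    · linarith [hlo x a, (hq x a).1]
    · linarith
  have hlip : LipschitzOnWith L (M.logG s m (1 / 2) qTY qA μ) B :=
    LipschitzOnWith.of_dist_le_mul fun q hq q' hq' => hL μ q q' (hB.1 hq) (hB.1 hq')
  obtain ⟨q, -, hq⟩ := isCompact_Icc.exists_fixedPoint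
    (Set.nonempty_Icc.2 fun _ _ => min_le_right _ _) hmaps hlip.continuousOn
    (D := fun z => Dist.dist z.1 z.2) continuous_dist (fun q hq hne => by
      refine (hL μ _ _ (hB.1 hq) (hB.1 (hmaps hq))).trans_lt ?_
      have hL1' : (L : ℝ) < 1 := hL1
      have := dist_pos.2 hne.symm
      nlinarith)
  exact ⟨q, (M.logG_eq_self_iff hqA (by norm_num) μ q).1 hq⟩

theorem exists_box_of_mem_closedBall (q : X → A → ℝ) (r : ℝ) :
    ∃ lo hi, ∀ q' ∈ Metric.closedBall q r, ∀ x a, lo ≤ q' x a ∧ q' x a ≤ hi := by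
  obtain ⟨lo, hlo⟩ := Finite.exists_ge (fun z : X × A => q z.1 z.2)
  obtain ⟨hi, hhi⟩ := Finite.exists_le (fun z : X × A => q z.1 z.2)
  refine ⟨lo - r, hi + r, fun q' hq' x a => ?_⟩
  have h1 : |q' x a - q x a| ≤ r := ((dist_le_pi_dist (q' x) (q x) a).trans
    (dist_le_pi_dist q' q x)).trans (Metric.mem_closedBall.1 hq')
  have h2 := hlo (x, a)
  have h3 := hhi (x, a)
  dsimp only at h2 h3
  rw [abs_le] at h1
  constructor <;> linarith

theorem exists_lipschitzOnWith_logG (hqA : ∀ a, 0 < qA a) (hβ0 : 0 < β) (hβ1 : β < 1) (μ : X → ℝ)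
    (q : X → A → ℝ) (r : ℝ) :
    ∃ L : NNReal, L < 1 ∧
      LipschitzOnWith L (M.logG s m β qTY qA μ) (Metric.closedBall q r) := by
  obtain ⟨lo, hi, hbox⟩ := exists_box_of_mem_closedBall q r
  obtain ⟨L, hL1, hL⟩ := M.exists_contraction_logG (s := s) (m := m) (qTY := qTY) hqA hβ0 hβ1 lo hi
  exact ⟨L, hL1, LipschitzOnWith.of_dist_le_mul fun q₁ h₁ q₂ h₂ =>
    hL μ q₁ q₂ (hbox q₁ h₁) (hbox q₂ h₂)⟩

theorem logG_dist_le (hqA : ∀ a, 0 < qA a) (hβ0 : 0 < β) (hβ1 : β < 1) {μ : X → ℝ}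
    {q : X → A → ℝ} (hq : M.logH s m qTY qA μ q = q) (r : ℝ) :
    ∃ L : NNReal, L < 1 ∧ ∀ q' ∈ Metric.closedBall q r,
      Dist.dist (M.logG s m β qTY qA μ q') q ≤ L * Dist.dist q' q := by
  obtain ⟨L, hL1, hL⟩ := M.exists_lipschitzOnWith_logG (s := s) (m := m) (qTY := qTY) hqA hβ0 hβ1
    μ q r
  refine ⟨L, hL1, fun q' hq' => ?_⟩
  have hr : 0 ≤ r := _root_.dist_nonneg.trans (Metric.mem_closedBall.1 hq')
  have := hL.dist_le_mul q' hq' q (Metric.mem_closedBall_self hr)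
  rwa [(M.logG_eq_self_iff hqA hβ1 μ q).2 hq] at this

theorem mapsTo_logG_closedBall (hqA : ∀ a, 0 < qA a) (hβ0 : 0 < β) (hβ1 : β < 1) {μ : X → ℝ}
    {q : X → A → ℝ} (hq : M.logH s m qTY qA μ q = q) (r : ℝ) :
    Set.MapsTo (M.logG s m β qTY qA μ) (Metric.closedBall q r) (Metric.closedBall q r) := by
  obtain ⟨L, hL1, hL⟩ := M.logG_dist_le hqA hβ0 hβ1 hq r
  intro q' hq'
  have hL1' : (L : ℝ) < 1 := hL1
  refine Metric.mem_closedBall.2 ((hL q' hq').trans (le_trans ?_ (Metric.mem_closedBall.1 hq')))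
  exact mul_le_of_le_one_left _root_.dist_nonneg hL1'.le

theorem logH_fixedPoint_unique (hqA : ∀ a, 0 < qA a) {μ : X → ℝ} {q q' : X → A → ℝ}
    (hq : M.logH s m qTY qA μ q = q) (hq' : M.logH s m qTY qA μ q' = q') : q' = q := by
  obtain ⟨L, hL1, hL⟩ := M.logG_dist_le (β := 1 / 2) hqA (by norm_num) (by norm_num) hq (Dist.dist q' q)
  have h := hL q' (Metric.mem_closedBall.2 le_rfl)
  rw [(M.logG_eq_self_iff hqA (by norm_num) μ q').2 hq'] at h
  by_contra hne
  have hL1' : (L : ℝ) < 1 := hL1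
  nlinarith [dist_pos.2 hne]

theorem tendsto_logG_iterate (hqA : ∀ a, 0 < qA a) (hβ0 : 0 < β) (hβ1 : β < 1) {μ : X → ℝ}
    {q : X → A → ℝ} (hq : M.logH s m qTY qA μ q = q) (q' : X → A → ℝ) :
    Tendsto (fun j : ℕ => (M.logG s m β qTY qA μ)^[j] q') atTop (𝓝 q) := by
  obtain ⟨L, hL1, hL⟩ := M.logG_dist_le hqA hβ0 hβ1 hq (Dist.dist q' q)
  have hmem : ∀ j : ℕ, (M.logG s m β qTY qA μ)^[j] q' ∈ Metric.closedBall q (Dist.dist q' q) := fun j =>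
    (M.mapsTo_logG_closedBall hqA hβ0 hβ1 hq _).iterate j (Metric.mem_closedBall.2 le_rfl)
  have hle : ∀ j : ℕ, Dist.dist ((M.logG s m β qTY qA μ)^[j] q') q ≤ (L : ℝ) ^ j * Dist.dist q' q := by
    intro j
    induction j with
    | zero => simp
    | succ j ih =>
      rw [Function.iterate_succ_apply', pow_succ', mul_assoc]
      exact (hL _ (hmem j)).trans (mul_le_mul_of_nonneg_left ih L.2)
  rw [tendsto_iff_dist_tendsto_zero]
  refine squeeze_zero (fun _ => _root_.dist_nonneg) hle ?_
  simpa using (tendsto_pow_atTop_nhds_zero_of_lt_one L.2 hL1).mul_const (Dist.dist q' q)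

theorem tendsto_gMap_iterate (hqA : ∀ a, 0 < qA a) (hβ0 : 0 < β) (hβ1 : β < 1) {μ : X → ℝ}
    {q : X → A → ℝ} (hq : M.logH s m qTY qA μ q = q) {P : X → A → ℝ} (hP : ∀ x a, 0 < P x a) :
    Tendsto (fun j : ℕ => (M.gMap s m β qTY qA μ)^[j] P) atTop
      (𝓝 (fun x a => (2 : ℝ) ^ q x a)) := by
  have e : P = fun x a => (2 : ℝ) ^ Real.logb 2 (P x a) := by
    ext x a
    rw [Real.rpow_logb two_pos (by norm_num) (hP x a)]
  have h := M.tendsto_logG_iterate hqA hβ0 hβ1 hq fun x a => Real.logb 2 (P x a)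
  rw [e]
  simp_rw [M.gMap_iterate_two_rpow hqA]
  simp only [tendsto_pi_nhds] at h ⊢
  exact fun x a => ((Real.continuous_const_rpow two_ne_zero).tendsto _).comp (h x a)

end ActionSource

namespace ActionSource

variable {X Y A Xh : Type*} [Fintype X] [Fintype Y] [Fintype A] [Fintype Xh]
  [DecidableEq Y] [DecidableEq A] (M : ActionSource X Y A Xh)

/-! ### The subgradient loop -/

variable (s m : ℝ) (β : ℝ) (qTY : Strategy Y A Xh → Y → ℝ) (qA : A → ℝ)

/-- The fixed point of `h` in log coordinates as a function of the dual variables. -/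
noncomputable def fixLog (μ : X → ℝ) : X → A → ℝ :=
  Classical.epsilon fun q => M.logH s m qTY qA μ q = q

/-- The total mass of the fixed point of `h`. -/
noncomputable def fixMass (μ : X → ℝ) (x : X) : ℝ := ∑ a, (2 : ℝ) ^ M.fixLog s m qTY qA μ x a

/-- A subgradient step of length `θ`. -/
noncomputable def dualStep (θ : ℝ) (μ : X → ℝ) (x : X) : ℝ :=
  μ x + θ / M.pX x * (1 - M.fixMass s m qTY qA μ x)

/-- The weighted square distance of the fixed points at two values of the dual variables. -/
noncomputable def fixGap (μ μ' : X → ℝ) : ℝ :=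
  ∑ x, ∑ a, M.pX x * (M.fixLog s m qTY qA μ x a - M.fixLog s m qTY qA μ' x a) ^ 2

/-- The Lyapunov function of the subgradient loop. -/
noncomputable def dualSq (μ μ' : X → ℝ) : ℝ := ∑ x, (M.pX x * (μ x - μ' x)) ^ 2

variable {s m β qTY qA}

theorem logH_fixLog (hqA : ∀ a, 0 < qA a) (μ : X → ℝ) :
    M.logH s m qTY qA μ (M.fixLog s m qTY qA μ) = M.fixLog s m qTY qA μ :=
  Classical.epsilon_spec (M.exists_logH_eq_self hqA μ)

theorem fixLog_le (hqA : ∀ a, 0 < qA a) (μ : X → ℝ) (x : X) (a : A) :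
    M.fixLog s m qTY qA μ x a ≤ (μ x + M.hBound s m qTY qA x a) / 2 := by
  have h := M.logH_le (s := s) (m := m) (qTY := qTY) hqA μ (M.fixLog s m qTY qA μ) x a
  rw [M.logH_fixLog hqA] at h
  linarith

theorem exists_hBound_bounds (hqA : ∀ a, 0 < qA a) : ∃ E, 0 ≤ E ∧ ∀ (μ : X → ℝ) (b : ℝ),
    (∀ x, μ x ≤ b) → ∀ x a, M.fixLog s m qTY qA μ x a ≤ (μ x + E) / 2 ∧
      μ x - E - (b + E) / 2 ≤ M.fixLog s m qTY qA μ x a := by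
  obtain ⟨E₁, hE₁⟩ := Finite.exists_le fun z : X × A => M.hBound s m qTY qA z.1 z.2
  obtain ⟨E₂, hE₂⟩ := Finite.exists_ge fun z : X × A =>
    Real.logb 2 (M.alphaA s m qTY qA z.2 z.1)
  refine ⟨max 0 (max E₁ (-E₂)), le_max_left _ _, fun μ b hμ => ?_⟩
  set E := max 0 (max E₁ (-E₂))
  have h1 : E₁ ≤ E := (le_max_left _ _).trans (le_max_right _ _)
  have h2 : -E₂ ≤ E := (le_max_right _ _).trans (le_max_right _ _)
  have hup : ∀ x a, M.fixLog s m qTY qA μ x a ≤ (μ x + E) / 2 := fun x a => by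
    have h3 := M.fixLog_le (s := s) (m := m) (qTY := qTY) hqA μ x a
    have h4 := hE₁ (x, a)
    dsimp only at h4
    linarith
  refine fun x a => ⟨hup x a, ?_⟩
  have h3 := M.le_logH (s := s) (m := m) (qTY := qTY) hqA μ (q := M.fixLog s m qTY qA μ) (a := a)
    (hi := (b + E) / 2) (fun x' => by linarith [hup x' a, hμ x']) x
  rw [M.logH_fixLog hqA] at h3
  have h4 := hE₂ (x, a)
  dsimp only at h4
  linarith

theorem exists_one_le_mul_pX : ∃ R, 0 < R ∧ ∀ x, 1 ≤ R * M.pX x := by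
  obtain ⟨δ, hδ, h⟩ := Finite.exists_pos_forall_le M.pX_pos
  exact ⟨δ⁻¹, inv_pos.2 hδ, fun x => by
    rw [← inv_mul_cancel₀ hδ.ne']
    exact mul_le_mul_of_nonneg_left (h x) (inv_pos.2 hδ).le⟩

/-- The subgradient loop stays in a box. -/
theorem exists_box_dualStep (hqA : ∀ a, 0 < qA a) :
    ∃ lo hi : ℝ, lo ≤ 1 ∧ 1 ≤ hi ∧ ∀ θ, 0 ≤ θ → θ ≤ 1 → ∀ μ : X → ℝ,
      (∀ x, lo ≤ μ x ∧ μ x ≤ hi) → ∀ x, lo ≤ M.dualStep s m qTY qA θ μ x ∧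
        M.dualStep s m qTY qA θ μ x ≤ hi := by
  obtain ⟨E, hE0, hE⟩ := M.exists_hBound_bounds (s := s) (m := m) (qTY := qTY) hqA
  obtain ⟨R, hR0, hR⟩ := M.exists_one_le_mul_pX
  have ⟨a₀⟩ := M.nonempty_action
  set N : ℝ := (Fintype.card A : ℝ) with hN
  have hN1 : 0 < N := by
    have : 0 < Fintype.card A := Fintype.card_pos_iff.2 ⟨a₀⟩
    exact Nat.cast_pos.2 this
  set hi := max 1 (3 * E + 2 * R)
  have hhi : 3 * E + 2 * R ≤ hi := le_max_right _ _
  set B := N * 2 ^ ((hi + E) / 2)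
  have hB0 : 0 ≤ B := by positivity
  set lo := min 1 (-E - 2 * Real.logb 2 N - R * B)
  have hlo : lo ≤ -E - 2 * Real.logb 2 N - R * B := min_le_right _ _
  refine ⟨lo, hi, min_le_left _ _, le_max_left _ _, fun θ hθ0 hθ1 μ hμ x => ?_⟩
  have hq := hE μ hi fun x => (hμ x).2
  have hθR : 0 ≤ θ / M.pX x ∧ θ / M.pX x ≤ R := by
    refine ⟨div_nonneg hθ0 (M.pX_pos x).le, ?_⟩
    rw [div_le_iff₀ (M.pX_pos x)]
    linarith [hR x]
  have hS0 : 0 ≤ M.fixMass s m qTY qA μ x := Finset.sum_nonneg fun a _ => by positivity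
  have hSle : ∀ c, μ x ≤ c → M.fixMass s m qTY qA μ x ≤ N * 2 ^ ((c + E) / 2) := fun c hc => by
    calc M.fixMass s m qTY qA μ x ≤ ∑ _a : A, (2 : ℝ) ^ ((c + E) / 2) :=
          Finset.sum_le_sum fun a _ => Real.rpow_le_rpow_of_exponent_le one_le_two (by
            linarith [(hq x a).1])
      _ = _ := by rw [Finset.sum_const, Finset.card_univ, nsmul_eq_mul]
  unfold dualStep
  set S := M.fixMass s m qTY qA μ x with hS
  set ρ := θ / M.pX x
  constructor
  · by_cases hc : μ x ≤ -E - 2 * Real.logb 2 N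
    · have h1 := hSle _ hc
      have h2 : (2 : ℝ) ^ ((-E - 2 * Real.logb 2 N + E) / 2) = N⁻¹ := by
        rw [show (-E - 2 * Real.logb 2 N + E) / 2 = -Real.logb 2 N by ring,
          Real.rpow_neg two_pos.le, Real.rpow_logb two_pos (by norm_num) hN1]
      rw [h2, mul_inv_cancel₀ hN1.ne'] at h1
      nlinarith [(hμ x).1, hθR.1]
    · have h1 := hSle _ (hμ x).2
      have h2 : ρ * S ≤ R * B := mul_le_mul hθR.2 h1 hS0 hR0.le
      nlinarith [hθR.1]
  · by_cases hc : (3 * E + hi) / 2 ≤ μ x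
    · have h1 : 1 ≤ S := by
        calc (1 : ℝ) ≤ 2 ^ M.fixLog s m qTY qA μ x a₀ :=
              Real.one_le_rpow one_le_two (by linarith [(hq x a₀).2])
          _ ≤ S := Finset.single_le_sum (f := fun a => (2 : ℝ) ^ M.fixLog s m qTY qA μ x a)
            (fun a _ => by positivity) (Finset.mem_univ a₀)
      nlinarith [(hμ x).2, hθR.1]
    · nlinarith [hθR.1, hθR.2, mul_nonneg hθR.1 hS0]

theorem fixLog_sub (hqA : ∀ a, 0 < qA a) (μ μ' : X → ℝ) (x : X) (a : A) :
    μ x - μ' x = (M.fixLog s m qTY qA μ x a - M.fixLog s m qTY qA μ' x a) +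
      ∑ y, M.W x a y * (M.lse (M.fixLog s m qTY qA μ) a y -
        M.lse (M.fixLog s m qTY qA μ') a y) := by
  have h := congrFun₂ (M.logH_fixLog (s := s) (m := m) (qTY := qTY) hqA μ) x a
  have h' := congrFun₂ (M.logH_fixLog (s := s) (m := m) (qTY := qTY) hqA μ') x a
  rw [M.logH_apply hqA] at h h'
  simp only [mul_sub, Finset.sum_sub_distrib]
  linarith

/-- Monotonicity of the mass in the dual variables. -/
theorem sum_le_sum_fixMass_sub (hqA : ∀ a, 0 < qA a) (μ μ' : X → ℝ) :
    ∑ x, ∑ a, M.pX x * ((M.fixLog s m qTY qA μ x a - M.fixLog s m qTY qA μ' x a) *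
      ((2 : ℝ) ^ M.fixLog s m qTY qA μ x a - 2 ^ M.fixLog s m qTY qA μ' x a)) ≤
    ∑ x, M.pX x * (μ x - μ' x) *
      (M.fixMass s m qTY qA μ x - M.fixMass s m qTY qA μ' x) := by
  set q := M.fixLog s m qTY qA μ with hq
  set q' := M.fixLog s m qTY qA μ' with hq'
  have e1 : ∑ x, M.pX x * (μ x - μ' x) *
      (M.fixMass s m qTY qA μ x - M.fixMass s m qTY qA μ' x) =
      ∑ x, ∑ a, M.pX x * ((q x a - q' x a) * ((2 : ℝ) ^ q x a - 2 ^ q' x a)) +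
      ∑ x, ∑ a, ∑ y, (M.lse q a y - M.lse q' a y) * (M.pX x * M.W x a y * (2 : ℝ) ^ q x a -
        M.pX x * M.W x a y * 2 ^ q' x a) := by
    rw [← Finset.sum_add_distrib]
    refine Finset.sum_congr rfl fun x _ => ?_
    unfold fixMass
    rw [← Finset.sum_sub_distrib, Finset.mul_sum, ← Finset.sum_add_distrib]
    refine Finset.sum_congr rfl fun a _ => ?_
    have e2 : ∑ y, (M.lse q a y - M.lse q' a y) * (M.pX x * M.W x a y * (2 : ℝ) ^ q x a -
        M.pX x * M.W x a y * 2 ^ q' x a) = M.pX x * (∑ y, M.W x a y *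
        (M.lse q a y - M.lse q' a y)) * ((2 : ℝ) ^ q x a - 2 ^ q' x a) := by
      rw [Finset.mul_sum, Finset.sum_mul]
      exact Finset.sum_congr rfl fun y _ => by ring
    rw [e2, M.fixLog_sub hqA μ μ' x a]
    ring
  rw [e1, le_add_iff_nonneg_right, Finset.sum_comm]
  refine Finset.sum_nonneg fun a _ => ?_
  rw [Finset.sum_comm]
  refine Finset.sum_nonneg fun y _ => ?_
  rw [← Finset.mul_sum, Finset.sum_sub_distrib]
  by_cases hW : ∃ x, 0 < M.W x a y
  · obtain ⟨x, hx⟩ := hW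
    have h1 := M.outputExp_pos q hx
    have h2 := M.outputExp_pos q' hx
    unfold lse
    rcases le_total (∑ x', M.pX x' * M.W x' a y * (2 : ℝ) ^ q x' a)
      (∑ x', M.pX x' * M.W x' a y * (2 : ℝ) ^ q' x' a) with h | h
    · have := Real.logb_le_logb_of_le one_lt_two h1 h
      exact mul_nonneg_of_nonpos_of_nonpos (by linarith) (by linarith)
    · have := Real.logb_le_logb_of_le one_lt_two h2 h
      exact mul_nonneg (by linarith) (by linarith)
  · have h0 : ∀ x, M.W x a y = 0 := fun x =>
      le_antisymm (not_lt.1 fun h => hW ⟨x, h⟩) (M.W_nonneg x a y)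
    simp [h0]

theorem abs_sub_le_of_fixLog (hqA : ∀ a, 0 < qA a) (μ μ' : X → ℝ) {d : ℝ}
    (hd : ∀ x a, |M.fixLog s m qTY qA μ x a - M.fixLog s m qTY qA μ' x a| ≤ d) (x : X) :
    |μ x - μ' x| ≤ 2 * d := by
  have key : ∀ μ μ' : X → ℝ,
      (∀ x a, |M.fixLog s m qTY qA μ x a - M.fixLog s m qTY qA μ' x a| ≤ d) →
      μ x - μ' x ≤ 2 * d := fun μ μ' hd => by
    have ⟨a⟩ := M.nonempty_action
    obtain ⟨S, hS0, hS1, -, hS⟩ := M.exists_weights_lse_sub_le (M.fixLog s m qTY qA μ)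
      (M.fixLog s m qTY qA μ') x a
    have h1 : ∑ x', S x' * (M.fixLog s m qTY qA μ x' a - M.fixLog s m qTY qA μ' x' a) ≤
        ∑ x', S x' * d :=
      Finset.sum_le_sum fun x' _ => mul_le_mul_of_nonneg_left (abs_le.1 (hd x' a)).2 (hS0 x')
    rw [← Finset.sum_mul, hS1, one_mul] at h1
    linarith [M.fixLog_sub (s := s) (m := m) (qTY := qTY) hqA μ μ' x a, (abs_le.1 (hd x a)).2]
  rw [abs_le]
  constructor
  · linarith [key μ' μ fun x a => by rw [abs_sub_comm]; exact hd x a]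
  · exact key μ μ' hd

theorem dualSq_nonneg (μ μ' : X → ℝ) : 0 ≤ M.dualSq μ μ' := Finset.sum_nonneg fun _ _ => sq_nonneg _

theorem fixGap_nonneg (μ μ' : X → ℝ) : 0 ≤ M.fixGap s m qTY qA μ μ' :=
  Finset.sum_nonneg fun x _ => Finset.sum_nonneg fun _ _ => mul_nonneg (M.pX_pos x).le (sq_nonneg _)

theorem exists_fixGap_bounds (hqA : ∀ a, 0 < qA a) (lo hi : ℝ) :
    ∃ c C : ℝ, 0 < c ∧ 0 < C ∧ ∀ μ μ' : X → ℝ, (∀ x, lo ≤ μ x ∧ μ x ≤ hi) →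
      (∀ x, lo ≤ μ' x ∧ μ' x ≤ hi) →
      c * M.fixGap s m qTY qA μ μ' ≤ ∑ x, M.pX x * (μ x - μ' x) *
        (M.fixMass s m qTY qA μ x - M.fixMass s m qTY qA μ' x) ∧
      ∑ x, (M.fixMass s m qTY qA μ x - M.fixMass s m qTY qA μ' x) ^ 2 ≤
        C * M.fixGap s m qTY qA μ μ' ∧
      M.dualSq μ μ' ≤ C * M.fixGap s m qTY qA μ μ' := by
  obtain ⟨E, hE0, hE⟩ := M.exists_hBound_bounds (s := s) (m := m) (qTY := qTY) hqA
  obtain ⟨R, hR0, hR⟩ := M.exists_one_le_mul_pX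
  have hl2 : 0 < Real.log 2 := Real.log_pos one_lt_two
  set N : ℝ := (Fintype.card A : ℝ) with hN
  have hN0 : 0 ≤ N := by positivity
  set ql := lo - E - (hi + E) / 2
  set qh := (hi + E) / 2
  have hbox : ∀ μ : X → ℝ, (∀ x, lo ≤ μ x ∧ μ x ≤ hi) → ∀ x a,
      ql ≤ M.fixLog s m qTY qA μ x a ∧ M.fixLog s m qTY qA μ x a ≤ qh := fun μ hμ x a => by
    have h1 := hE μ hi (fun x => (hμ x).2) x a
    exact ⟨by simp only [ql]; linarith [(hμ x).1], by simp only [qh]; linarith [(hμ x).2]⟩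
  set C₁ := N * (2 ^ qh * Real.log 2) ^ 2 * R with hC₁
  refine ⟨2 ^ ql * Real.log 2, max C₁ (4 * R), by positivity, lt_max_of_lt_right (by positivity),
    fun μ μ' hμ hμ' => ?_⟩
  have hg0 := M.fixGap_nonneg (s := s) (m := m) (qTY := qTY) (qA := qA) μ μ'
  set q := M.fixLog s m qTY qA μ with hq
  set q' := M.fixLog s m qTY qA μ' with hq'
  have hg : ∑ x, ∑ a, (q x a - q' x a) ^ 2 ≤ R * M.fixGap s m qTY qA μ μ' := by
    unfold fixGap
    rw [Finset.mul_sum]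
    refine Finset.sum_le_sum fun x _ => ?_
    rw [Finset.mul_sum]
    refine Finset.sum_le_sum fun a _ => ?_
    rw [← mul_assoc]
    exact le_mul_of_one_le_left (sq_nonneg _) (hR x)
  refine ⟨?_, ?_, ?_⟩
  · refine le_trans ?_ (M.sum_le_sum_fixMass_sub hqA μ μ')
    unfold fixGap
    rw [Finset.mul_sum]
    refine Finset.sum_le_sum fun x _ => ?_
    rw [Finset.mul_sum]
    refine Finset.sum_le_sum fun a _ => ?_
    rw [mul_left_comm]
    exact mul_le_mul_of_nonneg_left
      (mul_sq_le_mul_two_rpow_sub (hbox μ hμ x a).1 (hbox μ' hμ' x a).1) (M.pX_pos x).le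
  · refine le_trans ?_ (mul_le_mul_of_nonneg_right (le_max_left _ _) hg0)
    calc ∑ x, (M.fixMass s m qTY qA μ x - M.fixMass s m qTY qA μ' x) ^ 2
        ≤ ∑ x, N * ∑ a, ((2 ^ qh * Real.log 2) ^ 2 * (q x a - q' x a) ^ 2) := by
          refine Finset.sum_le_sum fun x _ => ?_
          unfold fixMass
          rw [← Finset.sum_sub_distrib]
          refine (sq_sum_le_card_mul_sum_sq (s := Finset.univ)).trans ?_
          rw [Finset.card_univ]
          refine mul_le_mul_of_nonneg_left (Finset.sum_le_sum fun a _ => ?_) hN0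
          rw [← mul_pow, sq_le_sq, abs_mul, abs_of_nonneg (a := 2 ^ qh * Real.log 2)
            (by positivity)]
          exact abs_two_rpow_sub_le (hbox μ hμ x a).2 (hbox μ' hμ' x a).2
      _ = N * (2 ^ qh * Real.log 2) ^ 2 * ∑ x, ∑ a, (q x a - q' x a) ^ 2 := by
          simp_rw [← Finset.mul_sum]
          ring
      _ ≤ N * (2 ^ qh * Real.log 2) ^ 2 * (R * M.fixGap s m qTY qA μ μ') :=
          mul_le_mul_of_nonneg_left hg (by positivity)
      _ = C₁ * M.fixGap s m qTY qA μ μ' := by rw [hC₁]; ring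
  · refine le_trans ?_ (mul_le_mul_of_nonneg_right (le_max_right _ _) hg0)
    have hd : ∀ x a, |q x a - q' x a| ≤ √(R * M.fixGap s m qTY qA μ μ') := fun x a => by
      refine Real.abs_le_sqrt (le_trans ?_ hg)
      exact (Finset.single_le_sum (f := fun a => (q x a - q' x a) ^ 2) (fun _ _ => sq_nonneg _)
        (Finset.mem_univ a)).trans (Finset.single_le_sum
          (f := fun x => ∑ a, (q x a - q' x a) ^ 2)
          (fun _ _ => Finset.sum_nonneg fun _ _ => sq_nonneg _) (Finset.mem_univ x))
    have hle := M.abs_sub_le_of_fixLog hqA μ μ' hd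
    calc M.dualSq μ μ' ≤ ∑ x, M.pX x * (4 * R * M.fixGap s m qTY qA μ μ') := by
          refine Finset.sum_le_sum fun x _ => ?_
          have h1 : (μ x - μ' x) ^ 2 ≤ 4 * R * M.fixGap s m qTY qA μ μ' := by
            rw [← sq_abs]
            refine (pow_le_pow_left₀ (abs_nonneg _) (hle x) 2).trans ?_
            rw [mul_pow, Real.sq_sqrt (mul_nonneg hR0.le hg0)]
            linarith
          rw [mul_pow]
          refine mul_le_mul ?_ h1 (sq_nonneg _) (M.pX_pos x).le
          rw [sq]
          exact mul_le_of_le_one_right (M.pX_pos x).le (M.pX_le_one x)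
      _ = 4 * R * M.fixGap s m qTY qA μ μ' := by rw [← Finset.sum_mul, M.pX_sum, one_mul]

theorem exists_fixGap_le_dualSq (hqA : ∀ a, 0 < qA a) (lo hi : ℝ) :
    ∃ C : ℝ, 0 < C ∧ ∀ μ μ' : X → ℝ, (∀ x, lo ≤ μ x ∧ μ x ≤ hi) →
      (∀ x, lo ≤ μ' x ∧ μ' x ≤ hi) → M.fixGap s m qTY qA μ μ' ≤ C * M.dualSq μ μ' := by
  obtain ⟨c, C, hc, hC, h⟩ := M.exists_fixGap_bounds (s := s) (m := m) (qTY := qTY) hqA lo hi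
  refine ⟨C / c ^ 2, by positivity, fun μ μ' hμ hμ' => ?_⟩
  obtain ⟨h1, h2, -⟩ := h μ μ' hμ hμ'
  have h3 : ∑ x, M.pX x * (μ x - μ' x) *
      (M.fixMass s m qTY qA μ x - M.fixMass s m qTY qA μ' x) ≤
      C / (2 * c) * M.dualSq μ μ' + c / (2 * C) *
        ∑ x, (M.fixMass s m qTY qA μ x - M.fixMass s m qTY qA μ' x) ^ 2 := by
    unfold dualSq
    rw [Finset.mul_sum, Finset.mul_sum, ← Finset.sum_add_distrib]
    refine Finset.sum_le_sum fun x _ => ?_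
    generalize M.pX x * (μ x - μ' x) = u
    generalize M.fixMass s m qTY qA μ x - M.fixMass s m qTY qA μ' x = v
    have : C / (2 * c) * u ^ 2 + c / (2 * C) * v ^ 2 - u * v =
        (C * u - c * v) ^ 2 / (2 * c * C) := by
      field_simp
      ring
    have h0 : 0 ≤ (C * u - c * v) ^ 2 / (2 * c * C) := by positivity
    linarith
  have h4 : c / (2 * C) * ∑ x, (M.fixMass s m qTY qA μ x - M.fixMass s m qTY qA μ' x) ^ 2 ≤
      c / 2 * M.fixGap s m qTY qA μ μ' := by
    refine (mul_le_mul_of_nonneg_left h2 (by positivity)).trans_eq ?_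
    field_simp
  have h5 : c / 2 * M.fixGap s m qTY qA μ μ' ≤ C / (2 * c) * M.dualSq μ μ' := by linarith
  have h6 := mul_le_mul_of_nonneg_left h5 (show 0 ≤ 2 / c by positivity)
  calc M.fixGap s m qTY qA μ μ' = 2 / c * (c / 2 * M.fixGap s m qTY qA μ μ') := by field_simp
    _ ≤ 2 / c * (C / (2 * c) * M.dualSq μ μ') := h6
    _ = _ := by field_simp

theorem continuous_dualSq : Continuous fun z : (X → ℝ) × (X → ℝ) => M.dualSq z.1 z.2 := by
  unfold dualSq
  fun_prop

theorem dualSq_self (μ : X → ℝ) : M.dualSq μ μ = 0 := by simp [dualSq]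

theorem tendsto_fixLog (hqA : ∀ a, 0 < qA a) {lo hi : ℝ} {ι : Type*} {l : Filter ι}
    {u : ι → X → ℝ} {μ : X → ℝ} (hu : ∀ᶠ i in l, ∀ x, lo ≤ u i x ∧ u i x ≤ hi)
    (hμ : ∀ x, lo ≤ μ x ∧ μ x ≤ hi) (h : Tendsto u l (𝓝 μ)) :
    Tendsto (fun i => M.fixLog s m qTY qA (u i)) l (𝓝 (M.fixLog s m qTY qA μ)) := by
  obtain ⟨C, hC, hle⟩ := M.exists_fixGap_le_dualSq (s := s) (m := m) (qTY := qTY) hqA lo hi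
  obtain ⟨R, hR0, hR⟩ := M.exists_one_le_mul_pX
  have hV : Tendsto (fun i => R * (C * M.dualSq (u i) μ)) l (𝓝 0) := by
    have h1 := (M.continuous_dualSq.tendsto (μ, μ)).comp (h.prodMk_nhds tendsto_const_nhds)
    rw [M.dualSq_self] at h1
    simpa using (h1.const_mul C).const_mul R
  refine tendsto_pi_nhds.2 fun x => tendsto_pi_nhds.2 fun a => ?_
  rw [tendsto_iff_dist_tendsto_zero]
  have h2 : Tendsto (fun i => √(R * (C * M.dualSq (u i) μ))) l (𝓝 0) := by
    simpa using hV.sqrt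
  refine squeeze_zero' (Eventually.of_forall fun _ => _root_.dist_nonneg) ?_ h2
  filter_upwards [hu] with i hi
  rw [Real.dist_eq]
  refine Real.abs_le_sqrt ?_
  refine le_trans ?_ (mul_le_mul_of_nonneg_left (hle (u i) μ hi hμ) hR0.le)
  calc (M.fixLog s m qTY qA (u i) x a - M.fixLog s m qTY qA μ x a) ^ 2
      ≤ R * (M.pX x * (M.fixLog s m qTY qA (u i) x a - M.fixLog s m qTY qA μ x a) ^ 2) := by
        rw [← mul_assoc]
        exact le_mul_of_one_le_left (sq_nonneg _) (hR x)
    _ ≤ R * M.fixGap s m qTY qA (u i) μ := by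
        refine mul_le_mul_of_nonneg_left ?_ hR0.le
        refine (Finset.single_le_sum (f := fun a => M.pX x *
          (M.fixLog s m qTY qA (u i) x a - M.fixLog s m qTY qA μ x a) ^ 2)
          (fun _ _ => mul_nonneg (M.pX_pos x).le (sq_nonneg _)) (Finset.mem_univ a)).trans ?_
        exact Finset.single_le_sum (f := fun x => ∑ a, M.pX x *
          (M.fixLog s m qTY qA (u i) x a - M.fixLog s m qTY qA μ x a) ^ 2)
          (fun x _ => Finset.sum_nonneg fun _ _ => mul_nonneg (M.pX_pos x).le (sq_nonneg _))
          (Finset.mem_univ x)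

theorem tendsto_two_rpow_fixLog {ι : Type*} {l : Filter ι} {u : ι → X → A → ℝ} {q : X → A → ℝ}
    (h : Tendsto u l (𝓝 q)) :
    Tendsto (fun i x a => (2 : ℝ) ^ u i x a) l (𝓝 fun x a => (2 : ℝ) ^ q x a) := by
  simp only [tendsto_pi_nhds] at h ⊢
  exact fun x a => ((Real.continuous_const_rpow two_ne_zero).tendsto _).comp (h x a)

theorem dualSq_dualStep (θ : ℝ) (μ μ' : X → ℝ) :
    M.dualSq (M.dualStep s m qTY qA θ μ) (M.dualStep s m qTY qA θ μ') =
      M.dualSq μ μ' - 2 * θ * ∑ x, M.pX x * (μ x - μ' x) *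
        (M.fixMass s m qTY qA μ x - M.fixMass s m qTY qA μ' x) +
      θ ^ 2 * ∑ x, (M.fixMass s m qTY qA μ x - M.fixMass s m qTY qA μ' x) ^ 2 := by
  unfold dualSq dualStep
  rw [Finset.mul_sum, Finset.mul_sum, ← Finset.sum_sub_distrib, ← Finset.sum_add_distrib]
  refine Finset.sum_congr rfl fun x _ => ?_
  have := (M.pX_pos x).ne'
  field_simp
  ring

/-- The optimal dual variables: the fixed point of `h` is a conditional pmf. -/
theorem exists_fixMass_eq_one (hqA : ∀ a, 0 < qA a) {lo hi : ℝ} (hlohi : lo ≤ hi)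
    (hbox : ∀ θ, 0 ≤ θ → θ ≤ 1 → ∀ μ : X → ℝ, (∀ x, lo ≤ μ x ∧ μ x ≤ hi) →
      ∀ x, lo ≤ M.dualStep s m qTY qA θ μ x ∧ M.dualStep s m qTY qA θ μ x ≤ hi) :
    ∃ μ : X → ℝ, (∀ x, lo ≤ μ x ∧ μ x ≤ hi) ∧ ∀ x, M.fixMass s m qTY qA μ x = 1 := by
  obtain ⟨c, C, hc, hC, h⟩ := M.exists_fixGap_bounds (s := s) (m := m) (qTY := qTY) hqA lo hi
  set θ := min 1 (c / C)
  have hθ0 : 0 < θ := lt_min one_pos (by positivity)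
  have hθ1 : θ ≤ 1 := min_le_left _ _
  have hθC : θ * C ≤ c := (le_div_iff₀ hC).1 (min_le_right _ _)
  set B : Set (X → ℝ) := Set.Icc (fun _ => lo) (fun _ => hi)
  have hB : ∀ {μ}, μ ∈ B ↔ ∀ x, lo ≤ μ x ∧ μ x ≤ hi := fun {μ} =>
    ⟨fun h x => ⟨h.1 x, h.2 x⟩, fun h => ⟨fun x => (h x).1, fun x => (h x).2⟩⟩
  have hmaps : Set.MapsTo (M.dualStep s m qTY qA θ) B B := fun μ hμ =>
    hB.2 (hbox θ hθ0.le hθ1 μ (hB.1 hμ))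
  have hcont : ContinuousOn (M.dualStep s m qTY qA θ) B := by
    intro μ hμ
    have h1 := M.tendsto_fixLog (s := s) (m := m) (qTY := qTY) hqA (l := 𝓝[B] μ) (u := id)
      (eventually_mem_nhdsWithin.mono fun μ hμ => hB.1 hμ) (hB.1 hμ)
      (tendsto_id.mono_left nhdsWithin_le_nhds)
    have h2 := tendsto_two_rpow_fixLog h1
    have h3 : Tendsto id (𝓝[B] μ) (𝓝 μ) := tendsto_id.mono_left nhdsWithin_le_nhds
    simp only [tendsto_pi_nhds] at h2 h3
    refine tendsto_pi_nhds.2 fun x => ?_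
    exact (h3 x).add ((tendsto_const_nhds.sub (tendsto_finsetSum _ fun a _ => h2 x a)).const_mul _)
  obtain ⟨μ, hμ, hfix⟩ := isCompact_Icc.exists_fixedPoint
    (Set.nonempty_Icc.2 fun _ => hlohi) hmaps hcont M.continuous_dualSq (fun μ hμ hne => by
      obtain ⟨h1, h2, h3⟩ := h μ _ (hB.1 hμ) (hB.1 (hmaps hμ))
      have hV : 0 < M.dualSq μ (M.dualStep s m qTY qA θ μ) := by
        obtain ⟨x, hx⟩ := Function.ne_iff.1 hne
        refine Finset.sum_pos' (fun _ _ => sq_nonneg _) ⟨x, Finset.mem_univ x, ?_⟩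
        have := sub_ne_zero.2 hx.symm
        have := (M.pX_pos x).ne'
        positivity
      have hg := pos_of_mul_pos_right (hV.trans_le h3) hC.le
      have h4 := mul_le_mul_of_nonneg_left h1 hθ0.le
      have h5 := mul_le_mul_of_nonneg_left h2 (sq_nonneg θ)
      have h6 := mul_le_mul_of_nonneg_right hθC (mul_pos hθ0 hg).le
      have h7 := mul_pos (mul_pos hθ0 hc) hg
      dsimp only
      rw [M.dualSq_dualStep]
      nlinarith)
  refine ⟨μ, hB.1 hμ, fun x => ?_⟩
  have h1 := congrFun hfix x
  unfold dualStep at h1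
  have h2 : θ / M.pX x * (1 - M.fixMass s m qTY qA μ x) = 0 := by linarith
  rcases mul_eq_zero.1 h2 with h3 | h3
  · exact absurd h3 (div_pos hθ0 (M.pX_pos x)).ne'
  · linarith

theorem dualIter_pos (hqA : ∀ a, 0 < qA a) (hβ0 : 0 < β) (hβ1 : β < 1) (i : ℕ) :
    (∀ x a, 0 < (M.dualIter s m β qTY qA i).2 x a) ∧
      (M.dualIter s m β qTY qA (i + 1)).2 =
        fun x a => (2 : ℝ) ^ M.fixLog s m qTY qA (M.dualIter s m β qTY qA i).1 x a := by
  have hlim : ∀ i, (∀ x a, 0 < (M.dualIter s m β qTY qA i).2 x a) →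
      (M.dualIter s m β qTY qA (i + 1)).2 =
        fun x a => (2 : ℝ) ^ M.fixLog s m qTY qA (M.dualIter s m β qTY qA i).1 x a :=
    fun i hi => (M.tendsto_gMap_iterate hqA hβ0 hβ1 (M.logH_fixLog hqA _) hi).limUnder_eq
  induction i with
  | zero =>
    refine (fun h => ⟨h, hlim 0 h⟩) fun x a => ?_
    have ⟨xh⟩ := M.nonempty_reproduction
    have : 0 < Fintype.card (Strategy Y A Xh) := Fintype.card_pos_iff.2 ⟨(fun _ => xh, a)⟩
    simp only [dualIter]
    positivity
  | succ i ih =>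
    refine (fun h => ⟨h, hlim (i + 1) h⟩) fun x a => ?_
    rw [ih.2]
    positivity

theorem dualIter_succ_fst (hqA : ∀ a, 0 < qA a) (hβ0 : 0 < β) (hβ1 : β < 1) (i : ℕ) :
    (M.dualIter s m β qTY qA (i + 1)).1 =
      M.dualStep s m qTY qA (1 / ((i : ℝ) + 1)) (M.dualIter s m β qTY qA i).1 := by
  have h := (M.dualIter_pos (s := s) (m := m) (qTY := qTY) hqA hβ0 hβ1 i).2
  ext x
  unfold dualStep fixMass
  have h' : ∀ a, (M.dualIter s m β qTY qA (i + 1)).2 x a = _ := fun a => congrFun₂ h x a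
  simp only [← h']
  rfl

theorem tendsto_dualIter_inner (hqA : ∀ a, 0 < qA a) (hβ0 : 0 < β) (hβ1 : β < 1) (i : ℕ) :
    Tendsto (fun j : ℕ => (M.gMap s m β qTY qA (M.dualIter s m β qTY qA i).1)^[j]
      (M.dualIter s m β qTY qA i).2) atTop (𝓝 (M.dualIter s m β qTY qA (i + 1)).2) := by
  obtain ⟨h1, h2⟩ := M.dualIter_pos (s := s) (m := m) (qTY := qTY) hqA hβ0 hβ1 i
  rw [h2]
  exact M.tendsto_gMap_iterate hqA hβ0 hβ1 (M.logH_fixLog hqA _) h1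

/-- Convergence of the subgradient loop to optimal dual variables. -/
theorem exists_tendsto_dualIter (hqA : ∀ a, 0 < qA a) (hβ0 : 0 < β) (hβ1 : β < 1) :
    ∃ μ : X → ℝ, (∀ x, M.fixMass s m qTY qA μ x = 1) ∧
      Tendsto (fun i => (M.dualIter s m β qTY qA i).1) atTop (𝓝 μ) ∧
      Tendsto (fun i => (M.dualIter s m β qTY qA i).2) atTop
        (𝓝 fun x a => (2 : ℝ) ^ M.fixLog s m qTY qA μ x a) := by
  obtain ⟨lo, hi, hlo1, h1hi, hbox⟩ := M.exists_box_dualStep (s := s) (m := m) (qTY := qTY) hqA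
  obtain ⟨μ, hμ, hS⟩ := M.exists_fixMass_eq_one hqA (hlo1.trans h1hi) hbox
  obtain ⟨c, C, hc, hC, h⟩ := M.exists_fixGap_bounds (s := s) (m := m) (qTY := qTY) hqA lo hi
  obtain ⟨C', hC', h'⟩ := M.exists_fixGap_le_dualSq (s := s) (m := m) (qTY := qTY) hqA lo hi
  set u : ℕ → X → ℝ := fun i => (M.dualIter s m β qTY qA i).1 with hu
  have hstep : ∀ i : ℕ, u (i + 1) = M.dualStep s m qTY qA (1 / ((i : ℝ) + 1)) (u i) :=
    M.dualIter_succ_fst hqA hβ0 hβ1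
  have hmem : ∀ i x, lo ≤ u i x ∧ u i x ≤ hi := by
    intro i
    induction i with
    | zero => exact fun x => ⟨hlo1, h1hi⟩
    | succ i ih =>
      rw [hstep]
      refine hbox _ (by positivity) ?_ _ ih
      rw [div_le_one (by positivity)]
      linarith [(Nat.cast_nonneg i : (0 : ℝ) ≤ i)]
  have hfix : ∀ θ, M.dualStep s m qTY qA θ μ = μ := fun θ => by
    ext x
    simp [dualStep, hS]
  have hVb : ∀ i, M.dualSq (u i) μ ≤ (hi - lo) ^ 2 := fun i => by
    calc M.dualSq (u i) μ ≤ ∑ x, M.pX x * (hi - lo) ^ 2 := by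
          refine Finset.sum_le_sum fun x _ => ?_
          rw [mul_pow, sq (M.pX x)]
          refine mul_le_mul (mul_le_of_le_one_right (M.pX_pos x).le (M.pX_le_one x)) ?_
            (sq_nonneg _) (M.pX_pos x).le
          rw [sq_le_sq, abs_of_nonneg (a := hi - lo) (by linarith), abs_le]
          constructor <;> linarith [(hmem i x).1, (hmem i x).2, (hμ x).1, (hμ x).2]
      _ = _ := by rw [← Finset.sum_mul, M.pX_sum, one_mul]
  have hV : Tendsto (fun i => M.dualSq (u i) μ) atTop (𝓝 0) := by
    refine tendsto_zero_of_le_sub_add (c := 2 * c / C) (B := C * (C' * (hi - lo) ^ 2))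
      (fun i => M.dualSq_nonneg _ _) (by positivity) fun i => ?_
    obtain ⟨h1, h2, h3⟩ := h (u i) μ (hmem i) hμ
    have hθ : (0 : ℝ) < 1 / ((i : ℝ) + 1) := by positivity
    rw [hstep, ← hfix (1 / ((i : ℝ) + 1)), M.dualSq_dualStep, hfix]
    set θ : ℝ := 1 / ((i : ℝ) + 1)
    have h4 := h' (u i) μ (hmem i) hμ
    have h5 : M.fixGap s m qTY qA (u i) μ ≤ C' * (hi - lo) ^ 2 :=
      h4.trans (mul_le_mul_of_nonneg_left (hVb i) hC'.le)
    have h6 := mul_le_mul_of_nonneg_left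
      (h2.trans (mul_le_mul_of_nonneg_left h5 hC.le)) (sq_nonneg θ)
    have h7 : 2 * c / C * θ * M.dualSq (u i) μ ≤ 2 * θ * (c * M.fixGap s m qTY qA (u i) μ) := by
      calc 2 * c / C * θ * M.dualSq (u i) μ
          ≤ 2 * c / C * θ * (C * M.fixGap s m qTY qA (u i) μ) :=
            mul_le_mul_of_nonneg_left h3 (by positivity)
        _ = _ := by field_simp
    have h8 := mul_le_mul_of_nonneg_left h1 (show 0 ≤ 2 * θ by positivity)
    linarith
  have hlim : Tendsto u atTop (𝓝 μ) := by
    refine tendsto_pi_nhds.2 fun x => ?_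
    obtain ⟨R, hR0, hR⟩ := M.exists_one_le_mul_pX
    rw [tendsto_iff_dist_tendsto_zero]
    have h2 : Tendsto (fun i => R * √(M.dualSq (u i) μ)) atTop (𝓝 0) := by
      simpa using hV.sqrt.const_mul R
    refine squeeze_zero (fun _ => _root_.dist_nonneg) (fun i => ?_) h2
    have h3 : |M.pX x * (u i x - μ x)| ≤ √(M.dualSq (u i) μ) :=
      Real.abs_le_sqrt (Finset.single_le_sum (f := fun x => (M.pX x * (u i x - μ x)) ^ 2)
        (fun _ _ => sq_nonneg _) (Finset.mem_univ x))
    rw [abs_mul, abs_of_pos (M.pX_pos x)] at h3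
    rw [Real.dist_eq]
    calc |u i x - μ x| ≤ R * M.pX x * |u i x - μ x| :=
          le_mul_of_one_le_left (abs_nonneg _) (hR x)
      _ = R * (M.pX x * |u i x - μ x|) := by ring
      _ ≤ _ := mul_le_mul_of_nonneg_left h3 hR0.le
  refine ⟨μ, hS, hlim, ?_⟩
  rw [← tendsto_add_atTop_iff_nat 1]
  have h1 := tendsto_two_rpow_fixLog (M.tendsto_fixLog (s := s) (m := m) (qTY := qTY) hqA
    (Eventually.of_forall hmem) hμ hlim)
  refine h1.congr fun i => ?_
  rw [(M.dualIter_pos hqA hβ0 hβ1 i).2]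

theorem exists_dualLimit_eq (hqA : ∀ a, 0 < qA a) (hβ0 : 0 < β) (hβ1 : β < 1) :
    ∃ μ : X → ℝ, Tendsto (fun i => (M.dualIter s m β qTY qA i).1) atTop (𝓝 μ) ∧
      Tendsto (fun i => (M.dualIter s m β qTY qA i).2) atTop (𝓝 (M.dualLimit s m β qTY qA)) ∧
      (∀ x, ∑ a, M.dualLimit s m β qTY qA x a = 1) ∧ (∀ x a, 0 < M.dualLimit s m β qTY qA x a) ∧
      ∀ x a, M.dualLimit s m β qTY qA x a =
        M.hMap s m qTY qA μ (M.dualLimit s m β qTY qA) x a := by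
  obtain ⟨μ, hS, h1, h2⟩ := M.exists_tendsto_dualIter (s := s) (m := m) (qTY := qTY) hqA hβ0 hβ1
  have e : M.dualLimit s m β qTY qA = fun x a => (2 : ℝ) ^ M.fixLog s m qTY qA μ x a :=
    h2.limUnder_eq
  refine ⟨μ, h1, e ▸ h2, fun x => by rw [e]; exact hS x, fun x a => by rw [e]; positivity,
    fun x a => ?_⟩
  rw [e]
  have h3 := congrFun₂ (M.logH_fixLog (s := s) (m := m) (qTY := qTY) hqA μ) x a
  beta_reduce
  conv_lhs => rw [← h3]
  unfold logH
  exact Real.rpow_logb two_pos (by norm_num)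
    (M.hMap_pos hqA μ (P := fun x a => (2 : ℝ) ^ M.fixLog s m qTY qA μ x a)
      (fun _ _ => by positivity) x a)

end ActionSource

namespace ActionSource

variable {X Y A Xh : Type*} [Fintype X] [Fintype Y] [Fintype A] [Fintype Xh]
  [DecidableEq Y] [DecidableEq A] (M : ActionSource X Y A Xh)

/-! ### Marginals and expectations -/

section Marginals

variable {U V : Type*} [Fintype U] [Fintype V] (η : U → A) (K : X → U → ℝ)

/-- The expectation of `f(X, U, Y)`. -/
noncomputable def expect (f : X → U → Y → ℝ) : ℝ :=
  ∑ x, ∑ u, ∑ y, M.joint η K x y u * f x u y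

/-- The marginal of side information and action. -/
noncomputable def margYA (y : Y) (a : A) : ℝ := ∑ x, ∑ u with η u = a, M.joint η K x y u

/-- The marginal of the action. -/
noncomputable def margA (a : A) : ℝ := ∑ x, ∑ u with η u = a, M.pX x * K x u

/-- The marginal of auxiliary variable and side information. -/
noncomputable def margUY (u : U) (y : Y) : ℝ := ∑ x, M.joint η K x y u

variable {η K}

theorem expect_add (f g : X → U → Y → ℝ) :
    M.expect η K (fun x u y => f x u y + g x u y) = M.expect η K f + M.expect η K g := by
  simp only [expect, mul_add, Finset.sum_add_distrib]

theorem expect_sub (f g : X → U → Y → ℝ) :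
    M.expect η K (fun x u y => f x u y - g x u y) = M.expect η K f - M.expect η K g := by
  simp only [expect, mul_sub, Finset.sum_sub_distrib]

theorem expect_const_mul (c : ℝ) (f : X → U → Y → ℝ) :
    M.expect η K (fun x u y => c * f x u y) = c * M.expect η K f := by
  simp only [expect, Finset.mul_sum]
  exact Finset.sum_congr rfl fun x _ => Finset.sum_congr rfl fun u _ =>
    Finset.sum_congr rfl fun y _ => by ring

theorem joint_nonneg (hK : ∀ x u, 0 ≤ K x u) (x : X) (y : Y) (u : U) : 0 ≤ M.joint η K x y u :=
  mul_nonneg (mul_nonneg (M.pX_pos x).le (hK x u)) (M.W_nonneg _ _ _)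

theorem expect_congr (hK : ∀ x u, 0 ≤ K x u) {f g : X → U → Y → ℝ}
    (h : ∀ x u y, 0 < K x u → 0 < M.W x (η u) y → f x u y = g x u y) :
    M.expect η K f = M.expect η K g := by
  refine Finset.sum_congr rfl fun x _ => Finset.sum_congr rfl fun u _ =>
    Finset.sum_congr rfl fun y _ => ?_
  rcases (hK x u).eq_or_lt with h0 | h1
  · simp [joint, ← h0]
  rcases (M.W_nonneg x (η u) y).eq_or_lt with h0 | h2
  · simp [joint, ← h0]
  · rw [h x u y h1 h2]

theorem expect_of_forall_Y (g : X → U → ℝ) :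
    M.expect η K (fun x u _ => g x u) = ∑ x, ∑ u, M.pX x * K x u * g x u := by
  refine Finset.sum_congr rfl fun x _ => Finset.sum_congr rfl fun u _ => ?_
  rw [← Finset.sum_mul]
  simp only [joint]
  rw [← Finset.mul_sum, M.W_sum, mul_one]

theorem expect_average (f : X → U → Y → ℝ) :
    M.expect η K (fun x u _ => ∑ y, M.W x (η u) y * f x u y) = M.expect η K f := by
  rw [expect_of_forall_Y]
  refine Finset.sum_congr rfl fun x _ => Finset.sum_congr rfl fun u _ => ?_
  rw [Finset.mul_sum]
  exact Finset.sum_congr rfl fun y _ => by rw [joint]; ring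

theorem expect_source (hK : IsKernel K) (g : X → ℝ) :
    M.expect η K (fun x _ _ => g x) = ∑ x, M.pX x * g x := by
  rw [M.expect_of_forall_Y fun x _ => g x]
  refine Finset.sum_congr rfl fun x _ => ?_
  rw [← Finset.sum_mul, ← Finset.mul_sum, hK.2, mul_one]

theorem sum_fiber_mul {ι : Type*} [Fintype ι] (η : ι → A) (f : ι → ℝ) (g : A → ℝ) :
    ∑ a, (∑ u with η u = a, f u) * g a = ∑ u, f u * g (η u) := by
  rw [← Finset.sum_fiberwise Finset.univ η]
  refine Finset.sum_congr rfl fun a _ => ?_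
  rw [Finset.sum_mul]
  exact Finset.sum_congr rfl fun u hu => by rw [(Finset.mem_filter.1 hu).2]

theorem sum_margYA_mul (g : Y → A → ℝ) :
    ∑ y, ∑ a, M.margYA η K y a * g y a = M.expect η K (fun _ u y => g y (η u)) := by
  have : ∀ y, ∑ a, M.margYA η K y a * g y a = ∑ x, ∑ u, M.joint η K x y u * g y (η u) := by
    intro y
    simp only [margYA, Finset.sum_mul (s := (Finset.univ : Finset X))]
    rw [Finset.sum_comm]
    exact Finset.sum_congr rfl fun x _ => sum_fiber_mul η (fun u => M.joint η K x y u) (g y)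
  simp only [this]
  rw [Finset.sum_comm]
  exact Finset.sum_congr rfl fun x _ => Finset.sum_comm

theorem sum_margA_mul (g : A → ℝ) :
    ∑ a, M.margA η K a * g a = M.expect η K (fun _ u _ => g (η u)) := by
  rw [M.expect_of_forall_Y fun _ u => g (η u)]
  simp only [margA, Finset.sum_mul (s := (Finset.univ : Finset X))]
  rw [Finset.sum_comm]
  exact Finset.sum_congr rfl fun x _ => sum_fiber_mul η (fun u => M.pX x * K x u) g

theorem sum_margUY_mul (g : U → Y → ℝ) :
    ∑ u, ∑ y, M.margUY η K u y * g u y = M.expect η K (fun _ u y => g u y) := by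
  have : ∀ u, ∑ y, M.margUY η K u y * g u y = ∑ x, ∑ y, M.joint η K x y u * g u y := by
    intro u
    simp only [margUY, Finset.sum_mul]
    exact Finset.sum_comm
  simp only [this]
  exact Finset.sum_comm

theorem expDist_eq_expect (φ : U → Y → Xh) :
    M.expDist η K φ = M.expect η K (fun x u y => M.dist x (φ u y)) := Finset.sum_comm

theorem expCost_eq_expect : M.expCost η K = M.expect η K (fun _ u _ => M.cost (η u)) := by
  rw [M.expect_of_forall_Y fun _ u => M.cost (η u)]
  exact Finset.sum_comm

theorem margYA_nonneg (hK : ∀ x u, 0 ≤ K x u) (y : Y) (a : A) : 0 ≤ M.margYA η K y a :=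
  Finset.sum_nonneg fun _ _ => Finset.sum_nonneg fun _ _ => M.joint_nonneg hK _ _ _

theorem margA_nonneg (hK : ∀ x u, 0 ≤ K x u) (a : A) : 0 ≤ M.margA η K a :=
  Finset.sum_nonneg fun x _ => Finset.sum_nonneg fun u _ => mul_nonneg (M.pX_pos x).le (hK x u)

theorem margUY_nonneg (hK : ∀ x u, 0 ≤ K x u) (u : U) (y : Y) : 0 ≤ M.margUY η K u y :=
  Finset.sum_nonneg fun _ _ => M.joint_nonneg hK _ _ _

variable {x : X} {u : U} {y : Y}

theorem joint_pos (h : 0 < K x u) (hW : 0 < M.W x (η u) y) : 0 < M.joint η K x y u :=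
  mul_pos (mul_pos (M.pX_pos x) h) hW

theorem margYA_pos (hK : ∀ x u, 0 ≤ K x u) (h : 0 < K x u) (hW : 0 < M.W x (η u) y) :
    0 < M.margYA η K y (η u) :=
  Finset.sum_pos' (fun _ _ => Finset.sum_nonneg fun _ _ => M.joint_nonneg hK _ _ _)
    ⟨x, Finset.mem_univ x, Finset.sum_pos' (fun _ _ => M.joint_nonneg hK _ _ _)
      ⟨u, by simp, M.joint_pos h hW⟩⟩

theorem margA_pos (hK : ∀ x u, 0 ≤ K x u) (h : 0 < K x u) : 0 < M.margA η K (η u) :=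
  Finset.sum_pos'
    (fun x _ => Finset.sum_nonneg fun u _ => mul_nonneg (M.pX_pos x).le (hK x u))
    ⟨x, Finset.mem_univ x, Finset.sum_pos' (fun u _ => mul_nonneg (M.pX_pos x).le (hK x u))
      ⟨u, by simp, mul_pos (M.pX_pos x) h⟩⟩

theorem margUY_pos (hK : ∀ x u, 0 ≤ K x u) (h : 0 < K x u) (hW : 0 < M.W x (η u) y) :
    0 < M.margUY η K u y :=
  Finset.sum_pos' (fun _ _ => M.joint_nonneg hK _ _ _)
    ⟨x, Finset.mem_univ x, M.joint_pos h hW⟩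

theorem sum_jointA_mul (x : X) (y : Y) (u : U) (g : A → ℝ) :
    ∑ a, M.jointA η K x y a u * g a = M.joint η K x y u * g (η u) := by
  rw [Finset.sum_eq_single (η u)]
  · simp [jointA, joint]
  · intro a _ ha
    simp [jointA, ha.symm]
  · simp

theorem sum_sum_jointA (x : X) (a : A) :
    ∑ y, ∑ u, M.jointA η K x y a u = M.pX x * ∑ u with η u = a, K x u := by
  rw [Finset.sum_comm, Finset.sum_filter, Finset.mul_sum]
  refine Finset.sum_congr rfl fun u _ => ?_
  simp only [jointA]
  rw [← Finset.mul_sum, M.W_sum]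
  split_ifs <;> simp

theorem sum_jointA (x : X) (y : Y) (a : A) :
    ∑ u, M.jointA η K x y a u = M.pX x * M.W x a y * ∑ u with η u = a, K x u := by
  rw [Finset.sum_filter, Finset.mul_sum]
  refine Finset.sum_congr rfl fun u _ => ?_
  simp only [jointA]
  split_ifs <;> ring

/-- `I(X; A) + I(X; U | Y, A)` as the expectation of an information density. -/
theorem rate_eq_expect (hK : IsKernel K) :
    M.rate η K = M.expect η K (fun x u y => Real.logb 2 (M.margYA η K y (η u)) -
      Real.logb 2 (M.margA η K (η u)) + (Real.logb 2 (K x u) -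
        Real.logb 2 (M.margUY η K u y))) := by
  set kA : X → A → ℝ := fun x a => ∑ u with η u = a, K x u with hkA
  have hk' : ∀ x a, ∑ u with η u = a, K x u = kA x a := fun _ _ => rfl
  have hX : ∀ x, ∑ a, M.pX x * kA x a = M.pX x := fun x => by
    rw [← Finset.mul_sum, Finset.sum_fiberwise, hK.2, mul_one]
  have hA : ∀ a, ∑ x, M.pX x * kA x a = M.margA η K a := fun a => by
    simp only [hkA, margA, Finset.mul_sum]
  have hYA : ∀ y a, ∑ x, M.pX x * M.W x a y * kA x a = M.margYA η K y a := fun y a => by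
    simp only [hkA, margYA, Finset.mul_sum]
    refine Finset.sum_congr rfl fun x _ => Finset.sum_congr rfl fun u hu => ?_
    rw [joint, (Finset.mem_filter.1 hu).2]
    ring
  have e1 : mutualInfo (fun x a => ∑ y, ∑ u, M.jointA η K x y a u) =
      M.expect η K (fun x u _ => Real.logb 2 (M.pX x * kA x (η u) /
        (M.pX x * M.margA η K (η u)))) := by
    rw [M.expect_of_forall_Y fun x u => Real.logb 2 (M.pX x * kA x (η u) /
      (M.pX x * M.margA η K (η u)))]
    simp only [mutualInfo, sum_sum_jointA, hk', hX, hA]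
    refine Finset.sum_congr rfl fun x _ => ?_
    simp only [hkA, Finset.mul_sum (s := Finset.filter _ _)]
    exact sum_fiber_mul η (fun u => M.pX x * K x u)
      fun a => Real.logb 2 ((∑ u with η u = a, M.pX x * K x u) / (M.pX x * M.margA η K a))
  have e2 : condMutualInfo (fun x u (ya : Y × A) => M.jointA η K x ya.1 ya.2 u) =
      M.expect η K (fun x u y => Real.logb 2 ((M.joint η K x y u * M.margYA η K y (η u)) /
        ((M.pX x * M.W x (η u) y * kA x (η u)) * M.margUY η K u y))) := by
    simp only [condMutualInfo, Fintype.sum_prod_type, sum_jointA, hk', hYA]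
    refine Finset.sum_congr rfl fun x _ => Finset.sum_congr rfl fun u _ =>
      Finset.sum_congr rfl fun y _ => ?_
    rw [M.sum_jointA_mul x y u fun a => Real.logb 2 ((M.jointA η K x y a u * M.margYA η K y a) /
      ((M.pX x * M.W x a y * kA x a) * ∑ x', M.jointA η K x' y a u))]
    simp [jointA, joint, margUY]
  rw [rate, e1, e2, ← expect_add]
  refine M.expect_congr hK.1 fun x u y h hW => ?_
  have hp := (M.pX_pos x).ne'
  have hk : kA x (η u) ≠ 0 :=
    (Finset.sum_pos' (fun u _ => hK.1 x u) ⟨u, by simp, h⟩ : 0 < kA x (η u)).ne'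
  have h1 := (M.margA_pos (η := η) hK.1 h).ne'
  have h2 := (M.margYA_pos hK.1 h hW).ne'
  have h3 := (M.margUY_pos hK.1 h hW).ne'
  have h4 := h.ne'
  have h5 := hW.ne'
  rw [joint, Real.logb_div (by positivity) (by positivity), Real.logb_div (by positivity)
    (by positivity), Real.logb_mul hp hk, Real.logb_mul hp h1, Real.logb_mul (by positivity) h2,
    Real.logb_mul (by positivity) h5, Real.logb_mul hp h4, Real.logb_mul (by positivity) h3,
    Real.logb_mul (by positivity) hk, Real.logb_mul hp h5]
  ring

/-! ### Processing of the auxiliary variable -/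

open Classical in
/-- The kernel of `τ(U)`. -/
noncomputable def pushKernel (τ : U → V) (K : X → U → ℝ) (x : X) (v : V) : ℝ :=
  ∑ u with τ u = v, K x u

theorem sum_pushKernel_mul (τ : U → V) (x : X) (g : V → ℝ) :
    ∑ v, pushKernel τ K x v * g v = ∑ u, K x u * g (τ u) := by
  classical
  rw [← Finset.sum_fiberwise Finset.univ τ]
  refine Finset.sum_congr rfl fun v _ => ?_
  rw [pushKernel, Finset.sum_mul]
  refine Finset.sum_congr (by congr) fun u hu => by rw [(Finset.mem_filter.1 hu).2]

theorem isKernel_pushKernel (τ : U → V) (hK : IsKernel K) : IsKernel (pushKernel τ K) :=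
  ⟨fun x _ => Finset.sum_nonneg fun u _ => hK.1 x u, fun x => by
    simpa [hK.2] using sum_pushKernel_mul (K := K) τ x fun _ => 1⟩

variable {τ : U → V} {η' : V → A}

theorem expect_pushKernel (hτ : ∀ u, η' (τ u) = η u) (f : X → V → Y → ℝ) :
    M.expect η' (pushKernel τ K) f = M.expect η K (fun x u y => f x (τ u) y) := by
  rw [← expect_average, ← M.expect_average (η := η), expect_of_forall_Y, expect_of_forall_Y]
  refine Finset.sum_congr rfl fun x _ => ?_
  simp only [mul_assoc]
  rw [← Finset.mul_sum, ← Finset.mul_sum,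
    sum_pushKernel_mul τ x fun v => ∑ y, M.W x (η' v) y * f x v y]
  simp only [hτ]

theorem margYA_pushKernel (hτ : ∀ u, η' (τ u) = η u) (y : Y) (a : A) :
    M.margYA η' (pushKernel τ K) y a = M.margYA η K y a := by
  refine Finset.sum_congr rfl fun x _ => ?_
  rw [Finset.sum_filter, Finset.sum_filter]
  have h := sum_pushKernel_mul (K := K) τ x fun v => if η' v = a then M.pX x * M.W x a y else 0
  simp only [hτ] at h
  convert h using 1 <;>
  · refine Finset.sum_congr rfl fun v _ => ?_
    split_ifs with h1
    · rw [joint, h1]; ring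
    · rw [mul_zero]

theorem margA_pushKernel (hτ : ∀ u, η' (τ u) = η u) (a : A) :
    M.margA η' (pushKernel τ K) a = M.margA η K a := by
  refine Finset.sum_congr rfl fun x _ => ?_
  rw [Finset.sum_filter, Finset.sum_filter]
  have h := sum_pushKernel_mul (K := K) τ x fun v => if η' v = a then M.pX x else 0
  simp only [hτ] at h
  convert h using 1 <;>
  · refine Finset.sum_congr rfl fun v _ => ?_
    split_ifs with h1
    · ring
    · rw [mul_zero]

open Classical in
theorem margUY_pushKernel (hτ : ∀ u, η' (τ u) = η u) (v : V) (y : Y) :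
    M.margUY η' (pushKernel τ K) v y = ∑ u with τ u = v, M.margUY η K u y := by
  unfold margUY
  rw [Finset.sum_comm]
  refine Finset.sum_congr rfl fun x _ => ?_
  rw [joint, pushKernel, Finset.mul_sum, Finset.sum_mul]
  refine Finset.sum_congr rfl fun u hu => ?_
  rw [joint, ← hτ, (Finset.mem_filter.1 hu).2]

/-- The data processing inequality for `U ↦ τ(U)` when the action is a function of `τ(U)`. -/
theorem rate_pushKernel_le (hK : IsKernel K) (hτ : ∀ u, η' (τ u) = η u) :
    M.rate η' (pushKernel τ K) ≤ M.rate η K := by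
  classical
  rw [M.rate_eq_expect hK, M.rate_eq_expect (isKernel_pushKernel τ hK), expect_add, expect_add]
  refine add_le_add (le_of_eq ?_) ?_
  · simp only [M.margYA_pushKernel hτ, M.margA_pushKernel hτ]
    rw [M.expect_pushKernel hτ]
    simp only [hτ]
  refine Finset.sum_le_sum fun x _ => ?_
  rw [← Finset.sum_fiberwise Finset.univ τ]
  refine Finset.sum_le_sum fun v _ => ?_
  rw [Finset.sum_comm]
  refine Finset.sum_le_sum fun y _ => ?_
  have e : ∑ u with τ u = v, M.joint η K x y u * (Real.logb 2 (K x u) -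
      Real.logb 2 (M.margUY η K u y)) = M.pX x * M.W x (η' v) y *
      ∑ u with τ u = v, K x u * (Real.logb 2 (K x u) - Real.logb 2 (M.margUY η K u y)) := by
    rw [Finset.mul_sum]
    refine Finset.sum_congr rfl fun u hu => ?_
    rw [joint, ← hτ, (Finset.mem_filter.1 hu).2]
    ring
  beta_reduce
  rw [e, M.margUY_pushKernel hτ, joint, mul_right_comm (M.pX x), mul_assoc (M.pX x * _)]
  rcases (M.W_nonneg x (η' v) y).eq_or_lt with h | h
  · simp [← h]
  refine mul_le_mul_of_nonneg_left ?_ (M.pX_mul_W_nonneg _ _ _)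
  unfold pushKernel
  refine log_sum_inequality _ (fun u _ => hK.1 x u) (fun u _ => M.margUY_nonneg hK.1 u y)
    fun u hu h0 => ?_
  by_contra hne
  refine (M.margUY_pos (η := η) hK.1 ((hK.1 x u).lt_of_ne' hne) (y := y) ?_).ne' h0
  rw [← hτ, (Finset.mem_filter.1 hu).2]
  exact h

end Marginals

end ActionSource

namespace ActionSource

variable {X Y A Xh : Type*} [Fintype X] [Fintype Y] [Fintype A] [Fintype Xh]
  [DecidableEq Y] [DecidableEq A] (M : ActionSource X Y A Xh)
  {s m β : ℝ} {qTY : Strategy Y A Xh → Y → ℝ} {qA : A → ℝ} {K K' : X → Strategy Y A Xh → ℝ}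

/-! ### The function `F` and its minimization -/

theorem QTY_eq_margUY (K : X → Strategy Y A Xh → ℝ) : M.QTY K = M.margUY Prod.snd K := by
  ext t y
  exact Finset.sum_congr rfl fun x _ => mul_right_comm _ _ _

theorem F_eq_expect (hK : IsKernel K) (hqA : ∀ a, 0 < qA a)
    (hq : ∀ x t y, 0 < M.W x t.2 y → 0 < qTY t y) :
    M.F s m K qTY qA = M.expect Prod.snd K (fun x t y =>
      Real.logb 2 (M.margYA Prod.snd K y t.2) + Real.logb 2 (K x t) -
        (Real.logb 2 (qA t.2) + m * M.cost t.2 +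
          (s * M.dist x (t.1 y) + Real.logb 2 (qTY t y)))) := by
  have e1 : ∑ y, ∑ a, M.pYA K y a * Real.logb 2 (M.pYA K y a / qA a) = M.expect Prod.snd K
      (fun _ t y => Real.logb 2 (M.margYA Prod.snd K y t.2 / qA t.2)) :=
    M.sum_margYA_mul fun y a => Real.logb 2 (M.margYA Prod.snd K y a / qA a)
  have e2 : ∑ x, ∑ y, ∑ t : Strategy Y A Xh, M.joint Prod.snd K x y t * Real.logb 2 (M.W x t.2 y) =
      M.expect Prod.snd K (fun x t y => Real.logb 2 (M.W x t.2 y)) :=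
    Finset.sum_congr rfl fun x _ => Finset.sum_comm
  have e3 : ∑ x, M.pX x * ∑ y, ∑ t : Strategy Y A Xh,
      (K x t * M.W x t.2 y) * Real.logb 2 ((K x t * M.W x t.2 y) / qTY t y) =
      M.expect Prod.snd K (fun x t y => Real.logb 2 ((K x t * M.W x t.2 y) / qTY t y)) := by
    refine Finset.sum_congr rfl fun x _ => ?_
    rw [Finset.sum_comm, Finset.mul_sum]
    refine Finset.sum_congr rfl fun t _ => ?_
    rw [Finset.mul_sum]
    exact Finset.sum_congr rfl fun y _ => by rw [joint]; ring
  have e4 : M.stratDist K = M.expect Prod.snd K (fun x t y => M.dist x (t.1 y)) :=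
    M.expDist_eq_expect _
  have e5 : M.stratCost K = M.expect Prod.snd K (fun _ t _ => M.cost t.2) := M.expCost_eq_expect
  rw [F, e1, e2, e3, e4, e5, ← expect_const_mul, ← expect_const_mul, ← expect_sub, ← expect_add,
    ← expect_sub, ← expect_sub]
  refine M.expect_congr hK.1 fun x t y h hW => ?_
  rw [Real.logb_div (M.margYA_pos (η := Prod.snd) hK.1 h hW).ne' (hqA _).ne',
    Real.logb_div (mul_pos h hW).ne' (hq x t y hW).ne', Real.logb_mul h.ne' hW.ne']
  ring

theorem objective_eq_expect (hK : IsKernel K) :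
    M.objective s m K = M.expect Prod.snd K (fun x t y =>
      Real.logb 2 (M.margYA Prod.snd K y t.2) + Real.logb 2 (K x t) -
        (Real.logb 2 (M.margA Prod.snd K t.2) + m * M.cost t.2 +
          (s * M.dist x (t.1 y) + Real.logb 2 (M.margUY Prod.snd K t y)))) := by
  rw [objective, stratRate, M.rate_eq_expect hK, stratDist, M.expDist_eq_expect, stratCost,
    M.expCost_eq_expect, ← expect_const_mul, ← expect_const_mul, ← expect_sub, ← expect_sub]
  congr 1
  ext x t y
  ring

theorem logb_alphaT (hqA : ∀ a, 0 < qA a) (t : Strategy Y A Xh) (x : X) :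
    Real.logb 2 (M.alphaT s m qTY qA t x) = ∑ y, M.W x t.2 y *
      (Real.logb 2 (qA t.2) + m * M.cost t.2 +
        (s * M.dist x (t.1 y) + Real.logb 2 (qTY t y))) := by
  unfold alphaT
  rw [Real.logb_mul (mul_ne_zero (hqA _).ne' (by positivity)) (by positivity),
    Real.logb_mul (hqA _).ne' (by positivity), Real.logb_rpow two_pos (by norm_num),
    Real.logb_rpow two_pos (by norm_num)]
  simp only [mul_add (M.W _ _ _) (Real.logb 2 (qA t.2) + m * M.cost t.2), Finset.sum_add_distrib]
  rw [← Finset.sum_mul, M.W_sum, one_mul]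

theorem F_eq_expect_alphaT (hK : IsKernel K) (hqA : ∀ a, 0 < qA a)
    (hq : ∀ x t y, 0 < M.W x t.2 y → 0 < qTY t y) :
    M.F s m K qTY qA = M.expect Prod.snd K (fun x t y =>
      Real.logb 2 (M.margYA Prod.snd K y t.2) + Real.logb 2 (K x t) -
        Real.logb 2 (M.alphaT s m qTY qA t x)) := by
  rw [M.F_eq_expect hK hqA hq, expect_sub, expect_sub]
  simp only [M.logb_alphaT hqA]
  rw [M.expect_average (η := Prod.snd) (fun x (t : Strategy Y A Xh) y => Real.logb 2 (qA t.2) +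
    m * M.cost t.2 + (s * M.dist x (t.1 y) + Real.logb 2 (qTY t y)))]

variable (K K') in
/-- The relative entropy of the kernels, averaged over the source. -/
noncomputable def klKernel : ℝ :=
  M.expect Prod.snd K (fun x t _ => Real.logb 2 (K x t) - Real.logb 2 (K' x t))

variable (K K') in
/-- The relative entropy of the marginals of side information and action. -/
noncomputable def klYA : ℝ :=
  M.expect Prod.snd K (fun _ t y =>
    Real.logb 2 (M.margYA Prod.snd K y t.2) - Real.logb 2 (M.margYA Prod.snd K' y t.2))

variable (K K') in
/-- The relative entropy of the action marginals. -/
noncomputable def klA : ℝ :=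
  M.expect Prod.snd K (fun _ t _ =>
    Real.logb 2 (M.margA Prod.snd K t.2) - Real.logb 2 (M.margA Prod.snd K' t.2))

variable (K K') in
/-- The relative entropy of the marginals of strategy and side information. -/
noncomputable def klTY : ℝ :=
  M.expect Prod.snd K (fun _ t y =>
    Real.logb 2 (M.margUY Prod.snd K t y) - Real.logb 2 (M.margUY Prod.snd K' t y))

theorem klYA_eq : M.klYA K K' = ∑ y, ∑ a, M.margYA Prod.snd K y a *
    (Real.logb 2 (M.margYA Prod.snd K y a) - Real.logb 2 (M.margYA Prod.snd K' y a)) :=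
  (M.sum_margYA_mul fun y a => Real.logb 2 (M.margYA Prod.snd K y a) -
    Real.logb 2 (M.margYA Prod.snd K' y a)).symm

theorem klA_eq : M.klA K K' = ∑ a, M.margA Prod.snd K a *
    (Real.logb 2 (M.margA Prod.snd K a) - Real.logb 2 (M.margA Prod.snd K' a)) :=
  (M.sum_margA_mul fun a => Real.logb 2 (M.margA Prod.snd K a) -
    Real.logb 2 (M.margA Prod.snd K' a)).symm

theorem klTY_eq : M.klTY K K' = ∑ t, ∑ y, M.margUY Prod.snd K t y *
    (Real.logb 2 (M.margUY Prod.snd K t y) - Real.logb 2 (M.margUY Prod.snd K' t y)) :=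
  (M.sum_margUY_mul fun t y => Real.logb 2 (M.margUY Prod.snd K t y) -
    Real.logb 2 (M.margUY Prod.snd K' t y)).symm

theorem sum_margYA (a : A) : ∑ y, M.margYA Prod.snd K y a = M.margA Prod.snd K a := by
  unfold margYA margA
  rw [Finset.sum_comm]
  refine Finset.sum_congr rfl fun x _ => ?_
  rw [Finset.sum_comm]
  refine Finset.sum_congr rfl fun t _ => ?_
  simp only [joint]
  rw [← Finset.mul_sum, M.W_sum, mul_one]

theorem sum_margA (hK : IsKernel K) : ∑ a, M.margA Prod.snd K a = 1 := by
  have h := M.sum_margA_mul (η := Prod.snd) (K := K) fun _ => 1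
  rw [M.expect_source hK fun _ => 1] at h
  simpa [M.pX_sum] using h

theorem sum_margUY (hK : IsKernel K) : ∑ t, ∑ y, M.margUY Prod.snd K t y = 1 := by
  have h := M.sum_margUY_mul (η := Prod.snd) (K := K) fun _ _ => 1
  rw [M.expect_source hK fun _ => 1] at h
  simpa [M.pX_sum] using h

theorem margA_pos_of_pos (hpos : ∀ x t, 0 < K x t) (a : A) : 0 < M.margA Prod.snd K a := by
  have ⟨x⟩ := M.nonempty_source
  have ⟨xh⟩ := M.nonempty_reproduction
  obtain ⟨t, rfl⟩ : ∃ t : Strategy Y A Xh, t.2 = a := ⟨(fun _ => xh, a), rfl⟩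
  exact M.margA_pos (η := Prod.snd) (fun x t => (hpos x t).le) (hpos x t)

theorem margUY_eq_zero (hpos : ∀ x t, 0 < K' x t) {t : Strategy Y A Xh} {y : Y}
    (h : M.margUY Prod.snd K' t y = 0) (x : X) : M.W x t.2 y = 0 := by
  by_contra hne
  exact (M.margUY_pos (η := Prod.snd) (fun x t => (hpos x t).le) (hpos x t)
    ((M.W_nonneg _ _ _).lt_of_ne' hne)).ne' h

theorem margYA_eq_zero (hpos : ∀ x t, 0 < K' x t) {a : A} {y : Y}
    (h : M.margYA Prod.snd K' y a = 0) : M.margYA Prod.snd K y a = 0 := by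
  have ⟨xh⟩ := M.nonempty_reproduction
  have h0 : ∀ x, M.W x a y = 0 := fun x => by
    by_contra hne
    exact (M.margYA_pos (η := Prod.snd) (fun x t => (hpos x t).le)
      (hpos x ((fun _ => xh, a) : Strategy Y A Xh)) ((M.W_nonneg _ _ _).lt_of_ne' hne)).ne' h
  refine Finset.sum_eq_zero fun x _ => Finset.sum_eq_zero fun t ht => ?_
  rw [joint, (Finset.mem_filter.1 ht).2, h0, mul_zero]

theorem klA_nonneg (hK : IsKernel K) (hK' : IsKernel K') (hpos : ∀ x t, 0 < K' x t) :
    0 ≤ M.klA K K' := by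
  rw [klA_eq]
  exact sum_mul_logb_sub_nonneg _ (fun a _ => M.margA_nonneg hK.1 a)
    (fun a _ => M.margA_nonneg hK'.1 a) (fun a _ h => absurd h (M.margA_pos_of_pos hpos a).ne')
    (by rw [M.sum_margA hK, M.sum_margA hK'])

theorem klTY_nonneg (hK : IsKernel K) (hK' : IsKernel K') (hpos : ∀ x t, 0 < K' x t) :
    0 ≤ M.klTY K K' := by
  rw [klTY_eq, ← Finset.sum_product']
  refine sum_mul_logb_sub_nonneg _ (fun z _ => M.margUY_nonneg hK.1 z.1 z.2)
    (fun z _ => M.margUY_nonneg hK'.1 z.1 z.2) (fun z _ h => ?_) ?_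
  · exact Finset.sum_eq_zero fun x _ => by rw [joint, M.margUY_eq_zero hpos h x, mul_zero]
  · rw [Finset.sum_product', Finset.sum_product', M.sum_margUY hK, M.sum_margUY hK']

theorem klA_le_klYA (hK : IsKernel K) (hK' : IsKernel K') (hpos : ∀ x t, 0 < K' x t) :
    M.klA K K' ≤ M.klYA K K' := by
  rw [klA_eq, klYA_eq, Finset.sum_comm]
  refine Finset.sum_le_sum fun a _ => ?_
  rw [← sum_margYA, ← M.sum_margYA (K := K')]
  exact log_sum_inequality _ (fun y _ => M.margYA_nonneg hK.1 y a)
    (fun y _ => M.margYA_nonneg hK'.1 y a) fun y _ h => M.margYA_eq_zero hpos h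

theorem klYA_nonneg (hK : IsKernel K) (hK' : IsKernel K') (hpos : ∀ x t, 0 < K' x t) :
    0 ≤ M.klYA K K' :=
  (M.klA_nonneg hK hK' hpos).trans (M.klA_le_klYA hK hK' hpos)

theorem klTY_le_klKernel (hK : IsKernel K) (hpos : ∀ x t, 0 < K' x t) :
    M.klTY K K' ≤ M.klKernel K K' := by
  have e : M.klKernel K K' = ∑ t, ∑ y, ∑ x, M.joint Prod.snd K x y t *
      (Real.logb 2 (M.joint Prod.snd K x y t) - Real.logb 2 (M.joint Prod.snd K' x y t)) := by
    have : M.klKernel K K' = M.expect Prod.snd K (fun x t y =>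
        Real.logb 2 (M.joint Prod.snd K x y t) - Real.logb 2 (M.joint Prod.snd K' x y t)) := by
      refine M.expect_congr hK.1 fun x t y h hW => ?_
      have hp := (M.pX_pos x).ne'
      rw [joint, joint, Real.logb_mul (mul_ne_zero hp h.ne') hW.ne', Real.logb_mul hp h.ne',
        Real.logb_mul (mul_ne_zero hp (hpos x t).ne') hW.ne', Real.logb_mul hp (hpos x t).ne']
      ring
    rw [this, expect, Finset.sum_comm]
    exact Finset.sum_congr rfl fun t _ => Finset.sum_comm
  rw [e, klTY_eq]
  refine Finset.sum_le_sum fun t _ => Finset.sum_le_sum fun y _ => ?_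
  refine log_sum_inequality _ (fun x _ => M.joint_nonneg hK.1 x y t)
    (fun x _ => M.joint_nonneg (fun x t => (hpos x t).le) x y t) fun x _ h => ?_
  have : M.W x t.2 y = 0 := by
    rcases mul_eq_zero.1 h with h | h
    · exact absurd h (mul_pos (M.pX_pos x) (hpos x t)).ne'
    · exact h
  rw [joint, this, mul_zero]

theorem sum_sq_sqrt_le_klKernel (hK : IsKernel K) (hK' : IsKernel K') (hpos : ∀ x t, 0 < K' x t) :
    ∑ x, M.pX x * ∑ t, (√(K x t) - √(K' x t)) ^ 2 ≤ Real.log 2 * M.klKernel K K' := by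
  rw [klKernel, M.expect_of_forall_Y fun x t => Real.logb 2 (K x t) - Real.logb 2 (K' x t),
    Finset.mul_sum]
  refine Finset.sum_le_sum fun x _ => ?_
  simp only [mul_assoc (M.pX x)]
  rw [← Finset.mul_sum, mul_left_comm]
  exact mul_le_mul_of_nonneg_left (sum_sq_sqrt_sub_le _ (fun t _ => hK.1 x t)
    (fun t _ => hK'.1 x t) (fun t _ h => absurd h (hpos x t).ne') (by rw [hK.2, hK'.2]))
    (M.pX_pos x).le

theorem klKernel_nonneg (hK : IsKernel K) (hK' : IsKernel K') (hpos : ∀ x t, 0 < K' x t) :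
    0 ≤ M.klKernel K K' := by
  have h := M.sum_sq_sqrt_le_klKernel hK hK' hpos
  have h0 : 0 ≤ ∑ x, M.pX x * ∑ t, (√(K x t) - √(K' x t)) ^ 2 :=
    Finset.sum_nonneg fun x _ => mul_nonneg (M.pX_pos x).le
      (Finset.sum_nonneg fun _ _ => sq_nonneg _)
  exact nonneg_of_mul_nonneg_right (h0.trans h) (Real.log_pos one_lt_two)

theorem F_marginals_eq (hK : IsKernel K) (hpos : ∀ x t, 0 < K' x t) :
    M.F s m K (M.QTY K') (M.QA K') = M.objective s m K + M.klA K K' + M.klTY K K' := by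
  have hqA : ∀ a, 0 < M.QA K' a := M.margA_pos_of_pos hpos
  rw [M.F_eq_expect hK hqA fun x t y hW => by
      rw [QTY_eq_margUY]
      exact M.margUY_pos (η := Prod.snd) (fun x t => (hpos x t).le) (hpos x t) hW,
    M.objective_eq_expect hK, klA, klTY, ← expect_add, ← expect_add, QTY_eq_margUY,
    show M.QA K' = M.margA Prod.snd K' from rfl]
  congr 1
  ext x t y
  ring

theorem isKernel_innerOutput (hqA : ∀ a, 0 < qA a) (hβ0 : 0 < β) (hβ1 : β < 1) :
    IsKernel (M.innerOutput s m β qTY qA) ∧ (∀ x t, 0 < M.innerOutput s m β qTY qA x t) ∧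
      ∀ x a, ∑ t : Strategy Y A Xh with t.2 = a, M.innerOutput s m β qTY qA x t =
        M.dualLimit s m β qTY qA x a := by
  obtain ⟨μ, -, -, h1, hP, -⟩ := M.exists_dualLimit_eq (s := s) (m := m) (qTY := qTY) hqA hβ0 hβ1
  have hpos : ∀ x t, 0 < M.innerOutput s m β qTY qA x t := fun x t =>
    mul_pos (div_pos (M.alphaT_pos hqA t x) (M.alphaA_pos hqA t.2 x)) (hP x t.2)
  have hfib : ∀ x a, ∑ t : Strategy Y A Xh with t.2 = a, M.innerOutput s m β qTY qA x t =
      M.dualLimit s m β qTY qA x a := fun x a => by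
    calc ∑ t : Strategy Y A Xh with t.2 = a, M.innerOutput s m β qTY qA x t
        = ∑ t : Strategy Y A Xh with t.2 = a, M.alphaT s m qTY qA t x /
            M.alphaA s m qTY qA a x * M.dualLimit s m β qTY qA x a :=
          Finset.sum_congr rfl fun t ht => by rw [innerOutput, (Finset.mem_filter.1 ht).2]
      _ = M.alphaA s m qTY qA a x / M.alphaA s m qTY qA a x * M.dualLimit s m β qTY qA x a := by
          rw [← Finset.sum_mul, ← Finset.sum_div]
          rfl
      _ = _ := by rw [div_self (M.alphaA_pos hqA a x).ne', one_mul]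
  refine ⟨⟨fun x t => (hpos x t).le, fun x => ?_⟩, hpos, hfib⟩
  rw [← h1 x, ← Finset.sum_fiberwise Finset.univ (Prod.snd : Strategy Y A Xh → A)]
  exact Finset.sum_congr rfl fun a _ => hfib x a

theorem logb_innerOutput (hqA : ∀ a, 0 < qA a) (hβ0 : 0 < β) (hβ1 : β < 1) :
    ∃ μ : X → ℝ, ∀ x t, Real.logb 2 (M.innerOutput s m β qTY qA x t) =
      Real.logb 2 (M.alphaT s m qTY qA t x) + μ x - ∑ y, M.W x t.2 y *
        Real.logb 2 (M.margYA Prod.snd (M.innerOutput s m β qTY qA) y t.2) := by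
  obtain ⟨μ, -, -, -, hP, hfix⟩ :=
    M.exists_dualLimit_eq (s := s) (m := m) (qTY := qTY) hqA hβ0 hβ1
  have hfib := (M.isKernel_innerOutput (s := s) (m := m) (qTY := qTY) hqA hβ0 hβ1).2.2
  refine ⟨μ, fun x t => ?_⟩
  have hm : ∀ y a, M.margYA Prod.snd (M.innerOutput s m β qTY qA) y a =
      ∑ x', M.pX x' * M.W x' a y * M.dualLimit s m β qTY qA x' a := fun y a => by
    refine Finset.sum_congr rfl fun x' _ => ?_
    rw [← hfib, Finset.mul_sum]
    refine Finset.sum_congr rfl fun t ht => ?_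
    rw [joint, (Finset.mem_filter.1 ht).2]
    ring
  simp only [hm]
  have hα := (M.alphaA_pos (s := s) (m := m) (qTY := qTY) hqA t.2 x).ne'
  have hαt := (M.alphaT_pos (s := s) (m := m) (qTY := qTY) hqA t x).ne'
  rw [innerOutput, Real.logb_mul (div_ne_zero hαt hα) (hP x t.2).ne', Real.logb_div hαt hα,
    hfix x t.2, M.logb_hMap hqA μ hP]
  ring

/-- The Pythagorean identity of the inner minimization. -/
theorem F_eq_F_innerOutput_add (hqA : ∀ a, 0 < qA a) (hβ0 : 0 < β) (hβ1 : β < 1)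
    (hq : ∀ x t y, 0 < M.W x t.2 y → 0 < qTY t y) (hK : IsKernel K) :
    M.F s m K qTY qA = M.F s m (M.innerOutput s m β qTY qA) qTY qA +
      M.klYA K (M.innerOutput s m β qTY qA) + M.klKernel K (M.innerOutput s m β qTY qA) := by
  obtain ⟨μ, hμ⟩ := M.logb_innerOutput (s := s) (m := m) (qTY := qTY) hqA hβ0 hβ1
  set K' := M.innerOutput s m β qTY qA with hK'def
  obtain ⟨hK', hpos, -⟩ := M.isKernel_innerOutput (s := s) (m := m) (qTY := qTY) hqA hβ0 hβ1
  have key : ∀ K, IsKernel K → M.F s m K qTY qA =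
      ∑ x, M.pX x * μ x + M.klYA K K' + M.klKernel K K' := by
    intro K hK
    rw [M.F_eq_expect_alphaT hK hqA hq, ← M.expect_source (η := Prod.snd) hK μ, klYA, klKernel,
      expect_sub (f := fun _ (t : Strategy Y A Xh) y => Real.logb 2 (M.margYA Prod.snd K y t.2)),
      ← M.expect_average (η := Prod.snd) (f := fun _ (t : Strategy Y A Xh) y =>
        Real.logb 2 (M.margYA Prod.snd K' y t.2)), ← expect_sub, ← expect_add, ← expect_add]
    congr 1
    ext x t y
    rw [hμ]
    ring
  have h1 := key K' hK'
  have h2 : M.klYA K' K' = 0 := by simp [klYA, expect]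
  have h3 : M.klKernel K' K' = 0 := by simp [klKernel, expect]
  rw [h2, h3, add_zero, add_zero] at h1
  rw [h1]
  exact key K hK

/-! ### Convergence of the outer algorithm -/

theorem baIter_isKernel_pos (hβ0 : 0 < β) (hβ1 : β < 1) {K₀ : X → Strategy Y A Xh → ℝ}
    (hK₀ : IsKernel K₀) (hpos : ∀ x t, 0 < K₀ x t) (k : ℕ) :
    IsKernel (M.baIter s m β K₀ k) ∧ ∀ x t, 0 < M.baIter s m β K₀ k x t := by
  induction k with
  | zero => exact ⟨hK₀, hpos⟩
  | succ k ih =>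
    have h := M.isKernel_innerOutput (s := s) (m := m) (qTY := M.QTY (M.baIter s m β K₀ k))
      (M.margA_pos_of_pos ih.2) hβ0 hβ1
    exact ⟨h.1, h.2.1⟩

theorem QTY_pos (hpos : ∀ x t, 0 < K x t) (x : X) (t : Strategy Y A Xh) (y : Y)
    (hW : 0 < M.W x t.2 y) : 0 < M.QTY K t y := by
  rw [QTY_eq_margUY]
  exact M.margUY_pos (η := Prod.snd) (fun x t => (hpos x t).le) (hpos x t) hW

theorem continuous_margA {U : Type*} [Fintype U] (η : U → A) (a : A) :
    Continuous fun K : X → U → ℝ => M.margA η K a := by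
  unfold margA
  fun_prop

theorem continuous_margYA {U : Type*} [Fintype U] (η : U → A) (y : Y) (a : A) :
    Continuous fun K : X → U → ℝ => M.margYA η K y a := by
  unfold margYA joint
  fun_prop

theorem continuous_margUY {U : Type*} [Fintype U] (η : U → A) (u : U) (y : Y) :
    Continuous fun K : X → U → ℝ => M.margUY η K u y := by
  unfold margUY joint
  fun_prop

theorem continuous_stratDist : Continuous M.stratDist := by
  unfold stratDist expDist joint
  fun_prop

theorem continuous_stratCost : Continuous M.stratCost := by
  unfold stratCost expCost
  fun_prop

theorem continuousOn_stratRate :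
    ContinuousOn M.stratRate {K : X → Strategy Y A Xh → ℝ | IsKernel K} := by
  have e : ∀ K : X → Strategy Y A Xh → ℝ, IsKernel K → M.stratRate K =
      (∑ y, ∑ a, M.margYA Prod.snd K y a * Real.logb 2 (M.margYA Prod.snd K y a)) -
      (∑ a, M.margA Prod.snd K a * Real.logb 2 (M.margA Prod.snd K a)) +
      ((∑ x, ∑ t, M.pX x * (K x t * Real.logb 2 (K x t))) -
      ∑ t, ∑ y, M.margUY Prod.snd K t y * Real.logb 2 (M.margUY Prod.snd K t y)) := by
    intro K hK
    rw [M.sum_margYA_mul fun y a => Real.logb 2 (M.margYA Prod.snd K y a),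
      M.sum_margA_mul fun a => Real.logb 2 (M.margA Prod.snd K a),
      M.sum_margUY_mul fun t y => Real.logb 2 (M.margUY Prod.snd K t y)]
    simp only [← mul_assoc (M.pX _)]
    rw [← M.expect_of_forall_Y (η := Prod.snd) fun x t => Real.logb 2 (K x t), ← expect_sub,
      ← expect_sub, ← expect_add, stratRate, M.rate_eq_expect hK]
  refine ContinuousOn.congr (Continuous.continuousOn ?_) e
  refine ((continuous_finsetSum _ fun y _ => continuous_finsetSum _ fun a _ =>
    continuous_mul_logb_two.comp (M.continuous_margYA Prod.snd y a)).sub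
    (continuous_finsetSum _ fun a _ =>
      continuous_mul_logb_two.comp (M.continuous_margA Prod.snd a))).add
    ((continuous_finsetSum _ fun x _ => continuous_finsetSum _ fun t _ =>
      (continuous_mul_logb_two.comp (continuous_apply_apply x t)).const_mul _).sub
    (continuous_finsetSum _ fun t _ => continuous_finsetSum _ fun y _ =>
      continuous_mul_logb_two.comp (M.continuous_margUY Prod.snd t y)))

theorem continuousOn_objective :
    ContinuousOn (M.objective s m) {K : X → Strategy Y A Xh → ℝ | IsKernel K} :=
  (M.continuousOn_stratRate.sub (M.continuous_stratDist.const_mul s).continuousOn).sub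
    (M.continuous_stratCost.const_mul m).continuousOn

theorem isCompact_kernels (X U : Type*) [Fintype X] [Fintype U] :
    IsCompact {K : X → U → ℝ | IsKernel K} := by
  have hc : IsClosed {K : X → U → ℝ | IsKernel K} := by
    unfold IsKernel
    simp only [Set.ofPred_and, Set.ofPred_forall]
    refine IsClosed.inter ?_ ?_
    · exact isClosed_iInter fun x => isClosed_iInter fun u =>
        isClosed_le continuous_const (continuous_apply_apply x u)
    · exact isClosed_iInter fun x => isClosed_eq
        (continuous_finsetSum _ fun u _ => continuous_apply_apply x u) continuous_const
  refine isCompact_Icc.of_isClosed_subset (s := Set.Icc (fun _ _ => 0) (fun _ _ => 1)) hc ?_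
  exact fun _ hK => ⟨fun x u => hK.1 x u, fun x u => hK.2 x ▸
    Finset.single_le_sum (fun u _ => hK.1 x u) (Finset.mem_univ u)⟩

/-- The relative entropies of the marginals vanish along a convergent sequence. -/
theorem tendsto_klA_add_klTY {u : ℕ → X → Strategy Y A Xh → ℝ}
    (hu : Tendsto u atTop (𝓝 K)) :
    Tendsto (fun k => M.klA K (u k) + M.klTY K (u k)) atTop (𝓝 0) := by
  have key : ∀ (f : (X → Strategy Y A Xh → ℝ) → ℝ), Continuous f →
      Tendsto (fun k => f K * (Real.logb 2 (f K) - Real.logb 2 (f (u k)))) atTop (𝓝 0) := by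
    intro f hf
    by_cases h0 : f K = 0
    · simp [h0]
    have h1 : Tendsto (fun k => Real.logb 2 (f (u k))) atTop (𝓝 (Real.logb 2 (f K))) :=
      (Real.continuousAt_logb h0).tendsto.comp ((hf.tendsto K).comp hu)
    simpa using (h1.const_sub (Real.logb 2 (f K))).const_mul (f K)
  simp only [klA_eq, klTY_eq]
  have h1 := tendsto_finsetSum (Finset.univ : Finset A) fun a _ =>
    key _ (M.continuous_margA Prod.snd a)
  have h2 := tendsto_finsetSum (Finset.univ : Finset (Strategy Y A Xh)) fun t _ =>
    tendsto_finsetSum (Finset.univ : Finset Y) fun y _ => key _ (M.continuous_margUY Prod.snd t y)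
  simpa using h1.add h2

theorem tendsto_of_klKernel {u : ℕ → X → Strategy Y A Xh → ℝ} (hK : IsKernel K)
    (hu : ∀ k, IsKernel (u k)) (hpos : ∀ k x t, 0 < u k x t)
    (h : Tendsto (fun k => M.klKernel K (u k)) atTop (𝓝 0)) : Tendsto u atTop (𝓝 K) := by
  obtain ⟨R, hR0, hR⟩ := M.exists_one_le_mul_pX
  refine tendsto_pi_nhds.2 fun x => tendsto_pi_nhds.2 fun t => ?_
  have h1 : Tendsto (fun k => √(R * (Real.log 2 * M.klKernel K (u k)))) atTop (𝓝 0) := by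
    simpa using ((h.const_mul (Real.log 2)).const_mul R).sqrt
  have h2 : Tendsto (fun k => √(u k x t)) atTop (𝓝 √(K x t)) := by
    rw [tendsto_iff_dist_tendsto_zero]
    refine squeeze_zero (fun _ => _root_.dist_nonneg) (fun k => ?_) h1
    rw [_root_.dist_comm, Real.dist_eq]
    refine Real.abs_le_sqrt ?_
    refine le_trans ?_ (mul_le_mul_of_nonneg_left
      (M.sum_sq_sqrt_le_klKernel hK (hu k) (hpos k)) hR0.le)
    calc (√(K x t) - √(u k x t)) ^ 2 ≤ R * (M.pX x * (√(K x t) - √(u k x t)) ^ 2) := by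
          rw [← mul_assoc]
          exact le_mul_of_one_le_left (sq_nonneg _) (hR x)
      _ ≤ R * (M.pX x * ∑ t, (√(K x t) - √(u k x t)) ^ 2) :=
          mul_le_mul_of_nonneg_left (mul_le_mul_of_nonneg_left
            (Finset.single_le_sum (f := fun t => (√(K x t) - √(u k x t)) ^ 2)
              (fun _ _ => sq_nonneg _) (Finset.mem_univ t)) (M.pX_pos x).le) hR0.le
      _ ≤ _ := mul_le_mul_of_nonneg_left
          (Finset.single_le_sum (f := fun x => M.pX x * ∑ t, (√(K x t) - √(u k x t)) ^ 2)
            (fun x _ => mul_nonneg (M.pX_pos x).le (Finset.sum_nonneg fun _ _ => sq_nonneg _))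
            (Finset.mem_univ x)) hR0.le
  have h3 := h2.pow 2
  simpa only [Real.sq_sqrt (hK.1 x t), Real.sq_sqrt ((hu _).1 x t)] using h3

/-- The iterates converge to a minimizer of the objective, and so do the values of `F`. -/
theorem exists_tendsto_baIter (hβ0 : 0 < β) (hβ1 : β < 1) {K₀ : X → Strategy Y A Xh → ℝ}
    (hK₀ : IsKernel K₀) (hpos₀ : ∀ x t, 0 < K₀ x t) :
    ∃ K, IsKernel K ∧ (∀ K', IsKernel K' → M.objective s m K ≤ M.objective s m K') ∧
      Tendsto (M.baIter s m β K₀) atTop (𝓝 K) ∧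
      Tendsto (fun k => M.F s m (M.baIter s m β K₀ (k + 1)) (M.QTY (M.baIter s m β K₀ k))
        (M.QA (M.baIter s m β K₀ k))) atTop (𝓝 (M.objective s m K)) := by
  have hker := fun k => (M.baIter_isKernel_pos (s := s) (m := m) hβ0 hβ1 hK₀ hpos₀ k).1
  have hpos := fun k => (M.baIter_isKernel_pos (s := s) (m := m) hβ0 hβ1 hK₀ hpos₀ k).2
  have hsucc : ∀ k, M.baIter s m β K₀ (k + 1) =
    M.innerOutput s m β (M.QTY (M.baIter s m β K₀ k)) (M.QA (M.baIter s m β K₀ k)) := fun _ => rfl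
  generalize M.baIter s m β K₀ = u at hker hpos hsucc ⊢
  set Fv : ℕ → ℝ := fun k => M.F s m (u (k + 1)) (M.QTY (u k)) (M.QA (u k)) with hFv
  have hFge : ∀ k, M.objective s m (u (k + 1)) ≤ Fv k := fun k => by
    simp only [hFv]
    rw [M.F_marginals_eq (hker (k + 1)) (hpos k)]
    linarith [M.klA_nonneg (hker (k + 1)) (hker k) (hpos k),
      M.klTY_nonneg (hker (k + 1)) (hker k) (hpos k)]
  have hpyth : ∀ K, IsKernel K → ∀ k, Fv k - M.objective s m K + M.klYA K (u (k + 1)) +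
      M.klKernel K (u (k + 1)) = M.klA K (u k) + M.klTY K (u k) := by
    intro K hK k
    have h1 : M.F s m K (M.QTY (u k)) (M.QA (u k)) =
        Fv k + M.klYA K (u (k + 1)) + M.klKernel K (u (k + 1)) := by
      simp only [hFv, hsucc]
      exact M.F_eq_F_innerOutput_add (M.margA_pos_of_pos (hpos k)) hβ0 hβ1
        (M.QTY_pos (hpos k)) hK
    have h2 := M.F_marginals_eq (s := s) (m := m) hK (hpos k)
    linarith
  have hdesc : ∀ K, IsKernel K → (∀ K', IsKernel K' → M.objective s m K ≤ M.objective s m K') →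
      (∀ k, 0 ≤ Fv k - M.objective s m K) ∧ Antitone (fun k => M.klA K (u k) + M.klTY K (u k)) ∧
      (∀ k, 0 ≤ M.klA K (u k) + M.klTY K (u k)) ∧
      (∀ k, Fv k - M.objective s m K ≤ (M.klA K (u k) + M.klTY K (u k)) -
        (M.klA K (u (k + 1)) + M.klTY K (u (k + 1)))) ∧
      ∀ k, M.klKernel K (u (k + 1)) ≤ M.klA K (u k) + M.klTY K (u k) := by
    intro K hK hmin
    have h1 : ∀ k, 0 ≤ Fv k - M.objective s m K := fun k => by
      linarith [hFge k, hmin _ (hker (k + 1))]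
    have h2 : ∀ k, Fv k - M.objective s m K ≤ (M.klA K (u k) + M.klTY K (u k)) -
        (M.klA K (u (k + 1)) + M.klTY K (u (k + 1))) := fun k => by
      linarith [hpyth K hK k, M.klA_le_klYA hK (hker (k + 1)) (hpos (k + 1)),
        M.klTY_le_klKernel hK (hpos (k + 1))]
    refine ⟨h1, antitone_nat_of_succ_le fun k => by linarith [h1 k, h2 k], fun k => ?_, h2,
      fun k => ?_⟩
    · exact add_nonneg (M.klA_nonneg hK (hker k) (hpos k)) (M.klTY_nonneg hK (hker k) (hpos k))
    · linarith [hpyth K hK k, h1 k, M.klYA_nonneg hK (hker (k + 1)) (hpos (k + 1))]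
  have hFlim : ∀ K, IsKernel K → (∀ K', IsKernel K' → M.objective s m K ≤ M.objective s m K') →
      Tendsto Fv atTop (𝓝 (M.objective s m K)) := by
    intro K hK hmin
    obtain ⟨h1, h2, h3, h4, -⟩ := hdesc K hK hmin
    have h5 := tendsto_atTop_ciInf h2 ⟨0, by rintro _ ⟨k, rfl⟩; exact h3 k⟩
    have h6 := h5.sub ((tendsto_add_atTop_iff_nat 1).2 h5)
    rw [sub_self] at h6
    have h7 := (squeeze_zero h1 h4 h6).add_const (M.objective s m K)
    simpa using h7
  obtain ⟨Kh, hKh, hminh⟩ := (isCompact_kernels X (Strategy Y A Xh)).exists_isMinOn ⟨K₀, hK₀⟩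
    (M.continuousOn_objective (s := s) (m := m))
  have hminh' : ∀ K', IsKernel K' → M.objective s m Kh ≤ M.objective s m K' :=
    fun K' hK' => hminh hK'
  obtain ⟨K, hK, φ, hφ, hlim⟩ := (isCompact_kernels X (Strategy Y A Xh)).tendsto_subseq
    (x := fun k => u (k + 1)) fun k => hker (k + 1)
  have hKobj : M.objective s m K ≤ M.objective s m Kh := by
    have h1 : Tendsto (fun j => M.objective s m (u (φ j + 1))) atTop (𝓝 (M.objective s m K)) :=
      (M.continuousOn_objective (s := s) (m := m) K hK).tendsto.comp
        (tendsto_nhdsWithin_iff.2 ⟨hlim, Eventually.of_forall fun j => hker _⟩)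
    exact le_of_tendsto_of_tendsto' h1 ((hFlim Kh hKh hminh').comp hφ.tendsto_atTop)
      fun j => hFge (φ j)
  have hmin : ∀ K', IsKernel K' → M.objective s m K ≤ M.objective s m K' := fun K' hK' =>
    hKobj.trans (hminh' K' hK')
  obtain ⟨-, h2, h3, -, h5⟩ := hdesc K hK hmin
  have hΨ : Tendsto (fun k => M.klA K (u k) + M.klTY K (u k)) atTop (𝓝 0) := by
    have h6 := tendsto_atTop_ciInf h2 ⟨0, by rintro _ ⟨k, rfl⟩; exact h3 k⟩
    have h7 := M.tendsto_klA_add_klTY hlim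
    have h8 := (h6.comp ((tendsto_add_atTop_nat 1).comp hφ.tendsto_atTop))
    rwa [tendsto_nhds_unique h8 h7] at h6
  have hKL : Tendsto (fun k => M.klKernel K (u (k + 1))) atTop (𝓝 0) :=
    squeeze_zero (fun k => M.klKernel_nonneg hK (hker _) (hpos _)) h5 hΨ
  refine ⟨K, hK, hmin, ?_, hFlim K hK hmin⟩
  exact (tendsto_add_atTop_iff_nat (f := u) 1).1
    (M.tendsto_of_klKernel hK (fun k => hker (k + 1)) (fun k => hpos (k + 1)) hKL)

/-! ### The rate-distortion-cost function on the exposed points -/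

theorem exists_isBestEstimate {U : Type*} [Fintype U] (η : U → A) (K : X → U → ℝ) :
    ∃ φ, M.IsBestEstimate η K φ := by
  have := M.nonempty_reproduction
  choose φ hφ using fun u y => Finite.exists_min fun xh => ∑ x, M.joint η K x y u * M.dist x xh
  exact ⟨φ, hφ⟩

theorem IsBestEstimate.expDist_le {U : Type*} [Fintype U] {η : U → A} {K : X → U → ℝ}
    {φ : U → Y → Xh} (h : M.IsBestEstimate η K φ) (ψ : U → Y → Xh) :
    M.expDist η K φ ≤ M.expDist η K ψ := by
  refine Finset.sum_le_sum fun u _ => ?_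
  rw [Finset.sum_comm (s := (Finset.univ : Finset X)),
    Finset.sum_comm (s := (Finset.univ : Finset X))]
  exact Finset.sum_le_sum fun y _ => h u y _

theorem stratRate_le_of_mem_rateSet (hs : s ≤ 0) (hm : m ≤ 0)
    (hmin : ∀ K', IsKernel K' → M.objective s m K ≤ M.objective s m K') {r : ℝ}
    (hr : r ∈ M.rateSet (M.stratDist K) (M.stratCost K)) : M.stratRate K ≤ r := by
  obtain ⟨n, L, η, φ, hL, -, hD, hC, rfl⟩ := hr
  set τ : Fin n → Strategy Y A Xh := fun u => (φ u, η u)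
  have hτ : ∀ u, (τ u).2 = η u := fun _ => rfl
  have h1 := hmin _ (isKernel_pushKernel τ hL)
  have h2 : M.stratRate (pushKernel τ L) ≤ M.rate η L := M.rate_pushKernel_le hL hτ
  have h3 : M.stratDist (pushKernel τ L) = M.expDist η L φ := by
    rw [stratDist, expDist_eq_expect, expDist_eq_expect, M.expect_pushKernel hτ]
  have h4 : M.stratCost (pushKernel τ L) = M.expCost η L := by
    rw [stratCost, expCost_eq_expect, expCost_eq_expect, M.expect_pushKernel hτ]
  unfold objective at h1
  rw [h3, h4] at h1
  nlinarith

theorem exists_mem_rateSet_le (hK : IsKernel K) :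
    ∃ r ∈ M.rateSet (M.stratDist K) (M.stratCost K), r ≤ M.stratRate K := by
  set e := Fintype.equivFin (Strategy Y A Xh)
  have hτ : ∀ t, (e.symm (e t)).2 = t.2 := fun t => by rw [e.symm_apply_apply]
  obtain ⟨φ, hφ⟩ := M.exists_isBestEstimate (fun i => (e.symm i).2) (pushKernel e K)
  refine ⟨_, ⟨_, pushKernel e K, fun i => (e.symm i).2, φ, isKernel_pushKernel _ hK, hφ, ?_, ?_,
    rfl⟩, M.rate_pushKernel_le hK hτ⟩
  · refine (hφ.expDist_le M fun i => (e.symm i).1).trans_eq ?_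
    rw [stratDist, expDist_eq_expect, expDist_eq_expect,
      M.expect_pushKernel (η' := fun i => (e.symm i).2) (τ := e) hτ]
    simp only [e.symm_apply_apply]
  · rw [stratCost, expCost_eq_expect, expCost_eq_expect,
      M.expect_pushKernel (η' := fun i => (e.symm i).2) (τ := e) hτ]
    simp only [e.symm_apply_apply, le_refl]

theorem isLeast_rateSet (hs : s ≤ 0) (hm : m ≤ 0) (hK : IsKernel K)
    (hmin : ∀ K', IsKernel K' → M.objective s m K ≤ M.objective s m K') :
    IsLeast (M.rateSet (M.stratDist K) (M.stratCost K)) (M.stratRate K) := by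
  obtain ⟨r, hr, hle⟩ := M.exists_mem_rateSet_le hK
  have h := le_antisymm hle (M.stratRate_le_of_mem_rateSet hs hm hmin hr)
  exact ⟨h ▸ hr, fun r hr => M.stratRate_le_of_mem_rateSet hs hm hmin hr⟩

end ActionSource

theorem mainTheorem1 {X Y A Xh : Type*} [Fintype X] [Fintype Y] [Fintype A] [Fintype Xh]
    [DecidableEq Y] [DecidableEq A] (M : ActionSource X Y A Xh)
    (s m β : ℝ) (hs : s ≤ 0) (hm : m ≤ 0) (hβ0 : 0 < β) (hβ1 : β < 1)
    (K₀ : X → Strategy Y A Xh → ℝ) (hK₀ : IsKernel K₀) (hK₀pos : ∀ x t, 0 < K₀ x t) :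
    -- every call of the inner algorithm converges and minimizes `F` over `P_{T|X}`
    (∀ (k : ℕ) (qTY : Strategy Y A Xh → Y → ℝ) (qA : A → ℝ),
      qTY = M.QTY (M.baIter s m β K₀ k) → qA = M.QA (M.baIter s m β K₀ k) →
      -- the fixed-point iteration, for any value of the dual variables
      (∀ μ : X → ℝ, ∃ q : X → A → ℝ,
        (∀ q', M.logH s m qTY qA μ q' = q' ↔ q' = q) ∧
        (∀ q', M.logG s m β qTY qA μ q' = q' ↔ q' = q) ∧
        (∀ r : ℝ, 0 < r →
          Set.MapsTo (M.logG s m β qTY qA μ) (Metric.closedBall q r) (Metric.closedBall q r) ∧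
          ∃ L : NNReal, L < 1 ∧
            LipschitzOnWith L (M.logG s m β qTY qA μ) (Metric.closedBall q r)) ∧
        (∀ P : X → A → ℝ, (∀ x a, 0 < P x a) →
          Tendsto (fun j : ℕ => (M.gMap s m β qTY qA μ)^[j] P) atTop
            (𝓝 (fun x a => (2 : ℝ) ^ q x a)))) ∧
      (∀ i : ℕ, Tendsto
        (fun j : ℕ => (M.gMap s m β qTY qA (M.dualIter s m β qTY qA i).1)^[j]
          (M.dualIter s m β qTY qA i).2) atTop (𝓝 (M.dualIter s m β qTY qA (i + 1)).2)) ∧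
      -- the subgradient loop
      (∃ μ : X → ℝ, Tendsto (fun i => (M.dualIter s m β qTY qA i).1) atTop (𝓝 μ)) ∧
      Tendsto (fun i => (M.dualIter s m β qTY qA i).2) atTop (𝓝 (M.dualLimit s m β qTY qA)) ∧
      -- the output
      IsKernel (M.baIter s m β K₀ (k + 1)) ∧
      (∀ K, IsKernel K → M.F s m (M.baIter s m β K₀ (k + 1)) qTY qA ≤ M.F s m K qTY qA)) ∧
    -- the whole algorithm converges to the rate-distortion-cost function
    ∃ K : X → Strategy Y A Xh → ℝ,
      IsKernel K ∧ (∀ K', IsKernel K' → M.objective s m K ≤ M.objective s m K') ∧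
      Tendsto (M.baIter s m β K₀) atTop (𝓝 K) ∧
      Tendsto (fun k => M.stratDist (M.baIter s m β K₀ k)) atTop (𝓝 (M.stratDist K)) ∧
      Tendsto (fun k => M.stratCost (M.baIter s m β K₀ k)) atTop (𝓝 (M.stratCost K)) ∧
      IsLeast (M.rateSet (M.stratDist K) (M.stratCost K))
        (M.rdc (M.stratDist K) (M.stratCost K)) ∧
      Tendsto (M.baRate s m β K₀) atTop (𝓝 (M.rdc (M.stratDist K) (M.stratCost K))) := by
  refine ⟨?_, ?_⟩
  · rintro k qTY qA rfl rfl
    obtain ⟨hK, hpos⟩ := M.baIter_isKernel_pos (s := s) (m := m) hβ0 hβ1 hK₀ hK₀pos k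
    have hqA : ∀ a, 0 < M.QA (M.baIter s m β K₀ k) a := M.margA_pos_of_pos hpos
    have hK' := M.baIter_isKernel_pos (s := s) (m := m) hβ0 hβ1 hK₀ hK₀pos (k + 1)
    refine ⟨fun μ => ?_, M.tendsto_dualIter_inner hqA hβ0 hβ1, ?_, ?_, hK'.1, fun K hK => ?_⟩
    · obtain ⟨q, hq⟩ := M.exists_logH_eq_self (s := s) (m := m)
        (qTY := M.QTY (M.baIter s m β K₀ k)) hqA μ
      have hiff : ∀ q', M.logH s m (M.QTY (M.baIter s m β K₀ k)) (M.QA (M.baIter s m β K₀ k)) μ q' =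
          q' ↔ q' = q :=
        fun q' => ⟨fun h => M.logH_fixedPoint_unique hqA hq h, fun h => h ▸ hq⟩
      exact ⟨q, hiff, fun q' => (M.logG_eq_self_iff hqA hβ1 μ q').trans (hiff q'),
        fun r _ => ⟨M.mapsTo_logG_closedBall hqA hβ0 hβ1 hq r,
          M.exists_lipschitzOnWith_logG hqA hβ0 hβ1 μ q r⟩,
        fun P hP => M.tendsto_gMap_iterate hqA hβ0 hβ1 hq hP⟩
    · obtain ⟨μ, h, -⟩ := M.exists_dualLimit_eq (s := s) (m := m)
        (qTY := M.QTY (M.baIter s m β K₀ k)) hqA hβ0 hβ1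
      exact ⟨μ, h⟩
    · obtain ⟨-, -, h, -⟩ := M.exists_dualLimit_eq (s := s) (m := m)
        (qTY := M.QTY (M.baIter s m β K₀ k)) hqA hβ0 hβ1
      exact h
    · have h := M.F_eq_F_innerOutput_add (s := s) (m := m) hqA hβ0 hβ1 (M.QTY_pos hpos) hK
      have h1 := M.klYA_nonneg hK hK'.1 hK'.2
      have h2 := M.klKernel_nonneg hK hK'.1 hK'.2
      rw [ActionSource.baIter] at h1 h2 ⊢
      linarith
  · obtain ⟨K, hK, hmin, hlim, hF⟩ :=
      M.exists_tendsto_baIter (s := s) (m := m) hβ0 hβ1 hK₀ hK₀pos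
    have hleast := M.isLeast_rateSet hs hm hK hmin
    have hrdc : M.rdc (M.stratDist K) (M.stratCost K) = M.stratRate K := hleast.csInf_eq
    have hD := (M.continuous_stratDist.tendsto K).comp hlim
    have hC := (M.continuous_stratCost.tendsto K).comp hlim
    refine ⟨K, hK, hmin, hlim, hD, hC, hrdc ▸ hleast, ?_⟩
    rw [hrdc]
    have h := (((hD.comp (tendsto_add_atTop_nat 1)).const_mul s).add
      ((hC.comp (tendsto_add_atTop_nat 1)).const_mul m)).add hF
    have e : s * M.stratDist K + m * M.stratCost K + M.objective s m K = M.stratRate K := by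
      rw [ActionSource.objective]
      ring
    rw [e] at h
    exact h
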